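/- For integers $n\ge 1$ and $k$ let $T_n(k)=\sum_{j\text{ odd}}\binom nj j^k$ (a positive rational number, an integer if $k\ge0$), and let $\nu$ denote the exponent of $2$, on nonzero rational numbers and on nonzero $2$-adic integers. Let $e\ge2$, let $n=2^e+1$ or $n=2^e+2$, and let $1\le i\le 2^{e-1}$. (1) There is a $2$-adic integer $x_{i,n}$ such that for all integers $x$ $$\nu\bigl(T_n(2^{e-1}x+i)\bigr)=\nu(x-x_{i,n})+n-2,$$ where in particular $x\ne x_{i,n}$, so that both exponents are finite. Moreover $$x_{i,2^e+1}\equiv\begin{cases}1+2^i\pmod{2^{i+1}}&\text{if } i=2^{e-2}\text{ or }i=2^{e-1},\\ 1\pmod{2^{i+1}}&\text{otherwise,}\end{cases}$$ and $$x_{i,2^e+2}\equiv\begin{cases}1+2^{i-1}\pmod{2^i}&\text{if }1\le i\le2^{e-2},\\ 1+2^i\pmod{2^{i+1}}&\text{if }2^{e-2}<i<2^{e-1}\text{ and }(e,i)\ne(3,3),\\ 1\pmod{2^{i+1}}&\text{if }i=2^{e-1}\text{ or }(e,i)=(3,3).\end{cases}$$ (2) Let $g(x)=\nu\bigl(T_n(2^{e-1}x+i)\bigr)-(n-2)$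 for integers $x$. Then $x_{i,n}=2^{t_0}+2^{t_1}+2^{t_2}+\cdots$ (convergent in the $2$-adic integers), where $t_0=g(0)$ and $t_{j+1}=g(2^{t_0}+\cdots+2^{t_j})$ for all $j\ge0$; here the $t_j$ are nonnegative integers with $t_0<t_1<t_2<\cdots$, so that this is the binary expansion of $x_{i,n}$. -/

import Mathlib

/-- The partial Stirling number `T_n(k) = ∑_{i odd} (n choose i) i^k`, for `n : ℕ` and an arbitrary
integer exponent `k`. It is a rational number (an integer if `0 ≤ k`); all bases `i` are odd,
hence nonzero, so negative exponents are unproblematic. -/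
def partialStirling (n : ℕ) (k : ℤ) : ℚ :=
  ∑ i ∈ (Finset.range (n + 1)).filter Odd, (n.choose i : ℚ) * (i : ℚ) ^ k

/-- The function `g(x) = ν(T_n(2^{e-1} x + i)) - (n - 2)` on the integers, where `ν` is the
exponent of `2` (on nonzero rational numbers). -/
def shiftedExponent (e n i : ℕ) (x : ℤ) : ℤ :=
  padicValRat 2 (partialStirling n (2 ^ (e - 1) * x + i)) - ((n : ℤ) - 2)

/-! Write M = 2^s with s = e - 1, so that n = 2M + 1 + δ with δ ∈ {0, 1}. The core is that F(x) =
T_n(Mx + i) / 2^(n-2) preserves 2-adic distances. By Newton's formula T_n(k + H) - T_n(k) is the sum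
over r ≥ 1 of C(H, r) Δ^r T_n(k), where Δ^r T_n(k) = ∑ C(n, 2l+1) (2l+1)^k (2l)^r has exponent at
least n - 2 + max(r - M, 0), with equality at r = M. If M divides H, then C(H, M) has exponent
ν(H/M) and all other terms are more divisible (`exists_odd_natPartialStirling_add`). Since j^(M·2^N)
→ 1 for odd j, the isometry extends to negative arguments (`norm_partialStirling_sub`).

A zero ξ of such an F is found greedily (`exists_padicInt_zero_of_isometry`): adding 2^ν(F(y)) to y
cancels the lowest binary digit of F(y). The exponents used are the binary digits of ξ, and ν(F(x))
= ν(x - ξ).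

In particular ν(ξ - 1) = ν(F(1)), so the residues come from T_n(M + i). As M + i < n, the odd sum
may be replaced by the even one, which supplies powers of 2 and leaves S(M+i, M) modulo 2 and S(M+i,
M+1) modulo 4 to decide. Modulo 4 the generating function ∏ 1/(1 - jX) collapses
(`stirlingSecond_modEq_four`) to binomial coefficients governed by Kummer's theorem. The exception
(e, i) = (3, 3) is S(7, 5) = 140, divisible by 4. -/

/-! ### Binomial sums over odd indices and their closed forms -/

/-- A sum over the odd numbers up to `n`, indexed by their halves. -/
theorem sum_filter_odd_eq_sum_range {R : Type*} [AddCommMonoid R] (n : ℕ) (g : ℕ → R)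
    (hg : ∀ j, n < j → g j = 0) :
    ∑ j ∈ (Finset.range (n + 1)).filter Odd, g j = ∑ l ∈ Finset.range (n + 1), g (2 * l + 1) := by
  have h : ∑ l ∈ (Finset.range (n + 1)).filter (fun l => 2 * l + 1 ≤ n), g (2 * l + 1) =
      ∑ l ∈ Finset.range (n + 1), g (2 * l + 1) := by
    refine Finset.sum_filter_of_ne fun l _ hl => ?_
    by_contra h
    exact hl (hg _ (by omega))
  rw [← h]
  symm
  refine Finset.sum_bij (fun l _ => 2 * l + 1) ?_ ?_ ?_ ?_
  · intro l hl
    simp only [Finset.mem_filter, Finset.mem_range] at hl ⊢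
    exact ⟨by omega, ⟨l, rfl⟩⟩
  · intro a _ b _ hab
    omega
  · intro b hb
    simp only [Finset.mem_filter, Finset.mem_range] at hb
    obtain ⟨hb, c, rfl⟩ := hb
    exact ⟨c, by simp only [Finset.mem_filter, Finset.mem_range]; omega, rfl⟩
  · intro a _
    rfl

theorem sum_range_two_mul_eq {R : Type*} [AddCommMonoid R] (g : ℕ → R) (B : ℕ) :
    ∑ j ∈ Finset.range (2 * B), g j = ∑ l ∈ Finset.range B, (g (2 * l) + g (2 * l + 1)) := by
  induction B with
  | zero => simp
  | succ B ih =>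
    rw [show 2 * (B + 1) = 2 * B + 1 + 1 by ring, Finset.sum_range_succ, Finset.sum_range_succ, ih,
      Finset.sum_range_succ, add_assoc]

/-- Coefficients of (1+X)^(N+2) + (1+X)^N = 2(1+X)^(N+1) + X²(1+X)^N. -/
theorem choose_add_two_odd (N l : ℕ) :
    (N + 2).choose (2 * (l + 1) + 1) + N.choose (2 * (l + 1) + 1) =
      2 * (N + 1).choose (2 * (l + 1) + 1) + N.choose (2 * l + 1) := by
  have h1 : (N + 2).choose (2 * (l + 1) + 1) = (N + 1).choose (2 * l + 2) +
    (N + 1).choose (2 * (l + 1) + 1) := Nat.choose_succ_succ _ _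
  have h2 : (N + 1).choose (2 * (l + 1) + 1) = N.choose (2 * l + 2) +
    N.choose (2 * (l + 1) + 1) := Nat.choose_succ_succ _ _
  have h3 : (N + 1).choose (2 * l + 2) = N.choose (2 * l + 1) + N.choose (2 * l + 2) :=
    Nat.choose_succ_succ _ _
  omega

/-- The sum `∑ₗ (N choose 2l+1) (l choose m)`. -/
def oddChooseSum (N m : ℕ) : ℕ :=
  ∑ l ∈ Finset.range (N + 1), N.choose (2 * l + 1) * l.choose m

theorem oddChooseSum_eq_sum_range {N B : ℕ} (m : ℕ) (h : N ≤ B) :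
    oddChooseSum N m = ∑ l ∈ Finset.range (B + 1), N.choose (2 * l + 1) * l.choose m := by
  refine Finset.sum_subset (Finset.range_subset_range.2 (by omega)) fun l _ hl => ?_
  rw [Finset.mem_range] at hl
  rw [Nat.choose_eq_zero_of_lt (by omega), zero_mul]

theorem oddChooseSum_add_two (N m : ℕ) :
    oddChooseSum (N + 2) m + oddChooseSum N m = 2 * oddChooseSum (N + 1) m +
      ∑ l ∈ Finset.range (N + 2), N.choose (2 * l + 1) * (l + 1).choose m := by
  rw [oddChooseSum_eq_sum_range (N := N) (B := N + 2) m (by omega),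
    oddChooseSum_eq_sum_range (N := N + 1) (B := N + 2) m (by omega), oddChooseSum,
    Finset.sum_range_succ' _ (N + 2), Finset.sum_range_succ' _ (N + 2),
    Finset.sum_range_succ' _ (N + 2)]
  have h : ∀ l ∈ Finset.range (N + 2),
      (N + 2).choose (2 * (l + 1) + 1) * (l + 1).choose m +
        N.choose (2 * (l + 1) + 1) * (l + 1).choose m =
      2 * ((N + 1).choose (2 * (l + 1) + 1) * (l + 1).choose m) +
        N.choose (2 * l + 1) * (l + 1).choose m := fun l _ => by
    rw [← add_mul, choose_add_two_odd]; ring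
  have h' := Finset.sum_congr rfl h
  rw [Finset.sum_add_distrib, Finset.sum_add_distrib, ← Finset.mul_sum] at h'
  simp only [mul_zero, zero_add, Nat.choose_one_right]
  linarith

theorem oddChooseSum_add_two_zero (N : ℕ) :
    oddChooseSum (N + 2) 0 = 2 * oddChooseSum (N + 1) 0 := by
  have h := oddChooseSum_add_two N 0
  rw [oddChooseSum_eq_sum_range (N := N) (B := N + 1) 0 (by omega)] at h
  simp only [Nat.choose_zero_right] at h
  exact Nat.add_right_cancel h

theorem oddChooseSum_add_two_succ (N m : ℕ) :
    oddChooseSum (N + 2) (m + 1) = 2 * oddChooseSum (N + 1) (m + 1) + oddChooseSum N m := by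
  have h := oddChooseSum_add_two N (m + 1)
  have h2 : ∑ l ∈ Finset.range (N + 2), N.choose (2 * l + 1) * (l + 1).choose (m + 1) =
      oddChooseSum N m + oddChooseSum N (m + 1) := by
    rw [oddChooseSum_eq_sum_range (N := N) (B := N + 1) _ (by omega),
      oddChooseSum_eq_sum_range (N := N) (B := N + 1) _ (by omega), ← Finset.sum_add_distrib]
    exact Finset.sum_congr rfl fun l _ => by rw [Nat.choose_succ_succ]; ring
  omega

theorem oddChooseSum_eq_zero {N m : ℕ} (h : N < 2 * m + 1) : oddChooseSum N m = 0 := by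
  refine Finset.sum_eq_zero fun l _ => ?_
  rcases lt_or_ge l m with hl | hl
  · rw [Nat.choose_eq_zero_of_lt hl, mul_zero]
  · rw [Nat.choose_eq_zero_of_lt (by omega), zero_mul]

/-- With d = N - 2m - 1 the recurrence in N becomes Pascal's rule, each step in d costing a factor
2. -/
theorem oddChooseSum_two_mul_add_one_add (m d : ℕ) :
    oddChooseSum (2 * m + 1 + d) m = (m + d).choose m * 2 ^ d := by
  suffices h : ∀ N m d, N = 2 * m + 1 + d → oddChooseSum N m = (m + d).choose m * 2 ^ d from
    h _ m d rfl
  intro N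
  induction N using Nat.strong_induction_on with
  | _ N ih =>
    intro m d hN
    match N, m, d with
    | 0, _, _ => omega
    | 1, m, d =>
      obtain ⟨rfl, rfl⟩ : m = 0 ∧ d = 0 := by omega
      decide
    | N + 2, 0, 0 => omega
    | N + 2, 0, d + 1 =>
      rw [oddChooseSum_add_two_zero, ih (N + 1) (by omega) 0 d (by omega)]
      simp [pow_succ, mul_comm]
    | N + 2, m + 1, 0 =>
      rw [oddChooseSum_add_two_succ, oddChooseSum_eq_zero (by omega),
        ih N (by omega) m 0 (by omega)]
      simp
    | N + 2, m + 1, d + 1 =>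
      rw [oddChooseSum_add_two_succ, ih (N + 1) (by omega) (m + 1) d (by omega),
        ih N (by omega) m (d + 1) (by omega), show m + 1 + (d + 1) = m + d + 1 + 1 by ring,
        Nat.choose_succ_succ, show m + (d + 1) = m + d + 1 by ring,
        show m + 1 + d = m + d + 1 by ring]
      ring

/-- The sum `∑ₗ (N choose 2l+1) l(l-1)⋯(l-m+1)`. -/
def oddDescSum (N m : ℕ) : ℕ :=
  ∑ l ∈ Finset.range (N + 1), N.choose (2 * l + 1) * l.descFactorial m

theorem oddDescSum_eq (N m : ℕ) : oddDescSum N m = m.factorial * oddChooseSum N m := by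
  rw [oddDescSum, oddChooseSum, Finset.mul_sum]
  exact Finset.sum_congr rfl fun l _ => by rw [Nat.descFactorial_eq_factorial_mul_choose]; ring

theorem oddDescSum_eq_zero {N m : ℕ} (h : N < 2 * m + 1) : oddDescSum N m = 0 := by
  rw [oddDescSum_eq, oddChooseSum_eq_zero h, mul_zero]

theorem oddDescSum_mul_factorial (m d : ℕ) :
    oddDescSum (2 * m + 1 + d) m * d.factorial = (m + d).factorial * 2 ^ d := by
  rw [oddDescSum_eq, oddChooseSum_two_mul_add_one_add, add_comm m d,
    ← Nat.add_choose_mul_factorial_mul_factorial]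
  ring

/-! ### Falling factorials and T_n at exponents below n -/

theorem pow_eq_sum_stirlingSecond_mul_descFactorial (l q : ℕ) :
    l ^ q = ∑ m ∈ Finset.range (q + 1), q.stirlingSecond m * l.descFactorial m := by
  induction q with
  | zero => simp
  | succ q ih =>
    have key : ∀ m, l * l.descFactorial m = l.descFactorial (m + 1) + m * l.descFactorial m := by
      intro m
      rw [Nat.descFactorial_succ, ← add_mul]
      rcases lt_or_ge l m with h | h
      · rw [Nat.descFactorial_of_lt h, mul_zero, mul_zero]
      · rw [Nat.sub_add_cancel h]
    rw [Finset.sum_range_succ', Nat.stirlingSecond_succ_zero, zero_mul, add_zero, pow_succ', ih,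
      Finset.mul_sum]
    simp only [Nat.stirlingSecond_succ_succ, add_mul _ (_ : ℕ) (Nat.descFactorial _ _),
      Finset.sum_add_distrib]
    have h1 : ∑ m ∈ Finset.range (q + 1), (m + 1) * q.stirlingSecond (m + 1) *
        l.descFactorial (m + 1) =
        ∑ m ∈ Finset.range (q + 1), m * q.stirlingSecond m * l.descFactorial m := by
      have := Finset.sum_range_succ' (fun m => m * q.stirlingSecond m * l.descFactorial m) (q + 1)
      rw [Finset.sum_range_succ, Nat.stirlingSecond_eq_zero_of_lt (Nat.lt_succ_self q)] at this
      simp only [mul_zero, zero_mul, add_zero] at this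
      exact this.symm
    have h2 : ∀ m, l * (q.stirlingSecond m * l.descFactorial m) =
        m * q.stirlingSecond m * l.descFactorial m +
          q.stirlingSecond m * l.descFactorial (m + 1) := fun m => by
      rw [mul_left_comm, key]; ring
    rw [h1, Finset.sum_congr rfl fun m _ => h2 m, Finset.sum_add_distrib]

/-- The expansion of (l+1)^(k+1) in falling factorials of l + 1, divided by l + 1. -/
theorem succ_pow_eq_sum_stirlingSecond_mul_descFactorial (l k : ℕ) :
    (l + 1) ^ k = ∑ m ∈ Finset.range (k + 1),
      (k + 1).stirlingSecond (m + 1) * l.descFactorial m := by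
  have h := pow_eq_sum_stirlingSecond_mul_descFactorial (l + 1) (k + 1)
  rw [Finset.sum_range_succ', Nat.stirlingSecond_succ_zero, zero_mul, add_zero, pow_succ'] at h
  refine Nat.eq_of_mul_eq_mul_left (Nat.succ_pos l) (h.trans ?_)
  rw [Finset.mul_sum]
  exact Finset.sum_congr rfl fun m _ => by rw [Nat.succ_descFactorial_succ, Nat.succ_eq_add_one]; ring

/-- `T_n(k)` for a natural exponent `k`. -/
def natPartialStirling (n k : ℕ) : ℕ :=
  ∑ l ∈ Finset.range (n + 1), n.choose (2 * l + 1) * (2 * l + 1) ^ k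

theorem partialStirling_natCast (n k : ℕ) :
    partialStirling n (k : ℤ) = (natPartialStirling n k : ℚ) := by
  rw [partialStirling, sum_filter_odd_eq_sum_range n
    (fun i => (n.choose i : ℚ) * (i : ℚ) ^ (k : ℤ)), natPartialStirling]
  · push_cast
    simp only [zpow_natCast]
  · intro j hj
    simp [Nat.choose_eq_zero_of_lt hj]

theorem alternating_sum_choose_mul_pow {n k : ℕ} (h : k < n) :
    ∑ j ∈ Finset.range (n + 1), (-1 : ℤ) ^ j * n.choose j * (j : ℤ) ^ k = 0 := by
  have h1 := congrFun (fwdDiff_iter_pow_eq_zero_of_lt (R := ℤ) h) 0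
  rw [fwdDiff_iter_eq_sum_shift] at h1
  have h2 : ∑ j ∈ Finset.range (n + 1), (-1 : ℤ) ^ j * n.choose j * (j : ℤ) ^ k =
      (-1) ^ n * ∑ j ∈ Finset.range (n + 1),
        (((-1 : ℤ) ^ (n - j) * n.choose j) • ((0 : ℤ) + j • (1 : ℤ)) ^ k) := by
    rw [Finset.mul_sum]
    refine Finset.sum_congr rfl fun j hj => ?_
    have hj : j ≤ n := by simpa [Nat.lt_succ_iff] using hj
    obtain ⟨d, rfl⟩ := Nat.exists_eq_add_of_le hj
    rw [Nat.add_sub_cancel_left, pow_add]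
    have : (-1 : ℤ) ^ d * (-1) ^ d = 1 := by rw [← mul_pow]; simp
    simp only [zero_add, nsmul_eq_mul, mul_one, smul_eq_mul]
    linear_combination (-((-1 : ℤ) ^ j * (j + d).choose j * (j : ℤ) ^ k)) * this
  rw [h2, h1]
  simp

/-- For exponents below `n`, the sums over the odd and the even numbers agree. -/
theorem natPartialStirling_succ_of_lt {N k : ℕ} (h : k < N) :
    natPartialStirling (N + 1) (k + 1) = (N + 1) * 2 ^ k *
      ∑ m ∈ Finset.range (k + 1), (k + 1).stirlingSecond (m + 1) * oddDescSum N m := by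
  have h1 := alternating_sum_choose_mul_pow (n := N + 1) (k := k + 1) (by omega)
  -- Zero terms are added to make the range even, so that indices pair up as 2l, 2l + 1.
  have h2 : ∑ j ∈ Finset.range (2 * (N + 2)), (-1 : ℤ) ^ j * (N + 1).choose j * (j : ℤ) ^ (k + 1) =
      0 := by
    rw [← h1]
    symm
    refine Finset.sum_subset (Finset.range_subset_range.2 (by omega)) fun l _ hl => ?_
    rw [Finset.mem_range] at hl
    rw [Nat.choose_eq_zero_of_lt (by omega)]
    simp
  rw [sum_range_two_mul_eq, Finset.sum_add_distrib] at h2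
  have h3 : ∑ l ∈ Finset.range (N + 2), (N + 1).choose (2 * l) * (2 * l) ^ (k + 1) =
      natPartialStirling (N + 1) (k + 1) := by
    rw [natPartialStirling]
    zify
    have h3 : ∀ l : ℕ, (-1 : ℤ) ^ (2 * l) = 1 := fun l => by rw [pow_mul, neg_one_sq, one_pow]
    simp only [pow_succ (-1 : ℤ), h3] at h2
    simp only [one_mul, mul_neg, mul_one, neg_mul, Finset.sum_neg_distrib, Nat.cast_mul,
      Nat.cast_ofNat, Nat.cast_add, Nat.cast_one] at h2
    linarith
  rw [← h3, Finset.sum_range_succ']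
  simp only [mul_zero, ne_eq, Nat.add_eq_zero_iff, one_ne_zero, and_false, not_false_eq_true,
    zero_pow, add_zero]
  -- Absorption turns C(N+1, 2l+2)(2l+2) into (N+1) C(N, 2l+1); it uses up one of the k + 1 factors
  -- 2l + 2, hence only 2^k remains.
  have h4 : ∀ l, (N + 1).choose (2 * (l + 1)) * (2 * (l + 1)) ^ (k + 1) =
      (N + 1) * 2 ^ k * (N.choose (2 * l + 1) * (l + 1) ^ k) := by
    intro l
    have := Nat.add_one_mul_choose_eq N (2 * l + 1)
    rw [show 2 * (l + 1) = 2 * l + 1 + 1 by ring, pow_succ', ← mul_assoc, ← this,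
      show 2 * l + 1 + 1 = 2 * (l + 1) by ring, mul_pow]
    ring
  rw [Finset.sum_congr rfl fun l _ => h4 l, ← Finset.mul_sum]
  congr 1
  simp only [succ_pow_eq_sum_stirlingSecond_mul_descFactorial, oddDescSum, Finset.mul_sum]
  rw [Finset.sum_comm]
  exact Finset.sum_congr rfl fun m _ => Finset.sum_congr rfl fun l _ => by ring

/-! ### Powers of 2 in factorials and in `oddDescSum` -/

theorem exists_odd_factorial_two_mul (a : ℕ) :
    ∃ u, Odd u ∧ (2 * a).factorial = 2 ^ a * a.factorial * u := by
  induction a with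
  | zero => exact ⟨1, odd_one, rfl⟩
  | succ a ih =>
    obtain ⟨u, hu, h⟩ := ih
    refine ⟨(2 * a + 1) * u, (odd_two_mul_add_one a).mul hu, ?_⟩
    rw [show 2 * (a + 1) = 2 * a + 1 + 1 by ring, Nat.factorial_succ, Nat.factorial_succ, h,
      Nat.factorial_succ a]
    ring

theorem exists_odd_factorial_two_mul_add (a : ℕ) {δ : ℕ} (hδ : δ ≤ 1) :
    ∃ u, Odd u ∧ (2 * a + δ).factorial = 2 ^ a * a.factorial * u := by
  obtain ⟨u, hu, h⟩ := exists_odd_factorial_two_mul a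
  interval_cases δ
  · exact ⟨u, hu, h⟩
  · exact ⟨(2 * a + 1) * u, (odd_two_mul_add_one a).mul hu, by
      rw [Nat.factorial_succ, h]; ring⟩

theorem exists_odd_factorial_two_pow (s : ℕ) :
    ∃ u, Odd u ∧ (2 ^ s).factorial = 2 ^ (2 ^ s - 1) * u := by
  induction s with
  | zero => exact ⟨1, odd_one, rfl⟩
  | succ s ih =>
    obtain ⟨u, hu, h⟩ := ih
    obtain ⟨w, hw, h'⟩ := exists_odd_factorial_two_mul (2 ^ s)
    refine ⟨u * w, hu.mul hw, ?_⟩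
    have h1 : 2 ^ (s + 1) - 1 = 2 ^ s + (2 ^ s - 1) := by
      have := Nat.one_le_two_pow (n := s)
      rw [pow_succ]; omega
    rw [h1, pow_add 2 (2 ^ s), pow_succ' 2 s, h', h]
    ring

/-- The power of 2 in (2a+δ)! is a + ν(a!), while (2^s + b)! is divisible by (2^s)!·a! and ν((2^s)!)
= 2^s - 1; the ν(a!) cancels. -/
theorem two_pow_dvd_of_mul_factorial_eq {s Q a b δ : ℕ} (hδ : δ ≤ 1) (hab : a ≤ b)
    (h : Q * (2 * a + δ).factorial = (2 ^ s + b).factorial * 2 ^ (2 * a + δ)) :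
    2 ^ (2 ^ s - 1 + a + δ) ∣ Q := by
  obtain ⟨u, hu, h1⟩ := exists_odd_factorial_two_mul_add a hδ
  obtain ⟨w, -, h2⟩ := exists_odd_factorial_two_pow s
  obtain ⟨c, hc⟩ : (2 ^ s).factorial * a.factorial ∣ (2 ^ s + b).factorial :=
    (mul_dvd_mul_left _ (Nat.factorial_dvd_factorial hab)).trans
      (Nat.factorial_mul_factorial_dvd_factorial_add _ _)
  refine (Nat.Coprime.pow_left _ (Nat.coprime_two_left.2 hu)).dvd_of_dvd_mul_right ?_
  refine ⟨w * c, ?_⟩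
  have h3 : 0 < 2 ^ a * a.factorial := by positivity
  refine Nat.eq_of_mul_eq_mul_left h3 ?_
  rw [h1, hc, h2] at h
  calc 2 ^ a * a.factorial * (Q * u) = Q * (2 ^ a * a.factorial * u) := by ring
    _ = _ := by rw [h]; ring

theorem two_pow_dvd_oddDescSum_two_mul {s m a : ℕ} (h : m + 1 + a = 2 ^ s) :
    2 ^ (2 ^ s + a) ∣ oddDescSum (2 * 2 ^ s) m := by
  have h1 := oddDescSum_mul_factorial m (2 * a + 1)
  rw [show 2 * m + 1 + (2 * a + 1) = 2 * 2 ^ s by omega,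
    show m + (2 * a + 1) = 2 ^ s + a by omega] at h1
  have h2 := two_pow_dvd_of_mul_factorial_eq le_rfl le_rfl h1
  rwa [show 2 ^ s - 1 + a + 1 = 2 ^ s + a by omega] at h2

theorem two_pow_dvd_oddDescSum {s m a δ : ℕ} (hδ : δ ≤ 1) (h : m + a = 2 ^ s) :
    2 ^ (2 ^ s - 1 + a + δ) ∣ oddDescSum (2 * 2 ^ s + 1 + δ) m := by
  have h1 := oddDescSum_mul_factorial m (2 * a + δ)
  rw [show 2 * m + 1 + (2 * a + δ) = 2 * 2 ^ s + 1 + δ by omega,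
    show m + (2 * a + δ) = 2 ^ s + (a + δ) by omega] at h1
  exact two_pow_dvd_of_mul_factorial_eq hδ (Nat.le_add_right a δ) h1

theorem oddDescSum_two_mul_add_one_self (M : ℕ) : oddDescSum (2 * M + 1) M = M.factorial := by
  simpa using oddDescSum_mul_factorial M 0

theorem oddDescSum_two_mul_add_two_self (M : ℕ) :
    oddDescSum (2 * M + 2) M = (M + 1).factorial * 2 := by
  simpa using oddDescSum_mul_factorial M 1

theorem oddDescSum_two_mul_add_three_self (M : ℕ) :
    oddDescSum (2 * M + 3) M = (M + 2).factorial * 2 := by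
  have h := oddDescSum_mul_factorial M 2
  rw [show 2 * M + 1 + 2 = 2 * M + 3 by ring, Nat.factorial_two] at h
  omega

theorem odd_two_pow_add_one {s : ℕ} (hs : 1 ≤ s) : Odd (2 ^ s + 1) :=
  (Nat.even_pow.2 ⟨even_two, by omega⟩).add_one

theorem exists_odd_oddDescSum_self {s δ : ℕ} (hs : 1 ≤ s) (hδ : δ ≤ 1) :
    ∃ u, Odd u ∧ oddDescSum (2 * 2 ^ s + 1 + δ) (2 ^ s) = 2 ^ (2 ^ s - 1 + δ) * u := by
  obtain ⟨u, hu, h⟩ := exists_odd_factorial_two_pow s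
  interval_cases δ
  · exact ⟨u, hu, by rw [add_zero, oddDescSum_two_mul_add_one_self, h, add_zero]⟩
  · refine ⟨(2 ^ s + 1) * u, (odd_two_pow_add_one hs).mul hu, ?_⟩
    rw [oddDescSum_two_mul_add_two_self, Nat.factorial_succ, h, pow_succ]
    ring

/-- With M = 2^s, the factor 2^m exactly compensates the loss in the bound M - 1 + (M - m) + δ, so n
- 2 = 2M - 1 + δ serves for every m. -/
theorem two_pow_dvd_two_pow_mul_oddDescSum {s δ : ℕ} (hδ : δ ≤ 1) (m : ℕ) :
    2 ^ (2 * 2 ^ s - 1 + δ) ∣ 2 ^ m * oddDescSum (2 * 2 ^ s + 1 + δ) m := by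
  rcases lt_or_ge (2 ^ s) m with h | h
  · rw [oddDescSum_eq_zero (by omega), mul_zero]
    exact dvd_zero _
  · obtain ⟨a, ha⟩ := Nat.exists_eq_add_of_le h
    have h1 := mul_dvd_mul_left (2 ^ m) (two_pow_dvd_oddDescSum hδ ha.symm)
    rw [← pow_add] at h1
    have := Nat.one_le_two_pow (n := s)
    exact (pow_dvd_pow 2 (by omega)).trans h1

/-! ### Finite differences of T_n -/

/-- The `q`-th Mahler coefficient of `k ↦ T_n(k)`. -/
def mahlerCoeff (n q : ℕ) : ℕ :=
  ∑ l ∈ Finset.range (n + 1), n.choose (2 * l + 1) * (2 * l) ^ q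

theorem mahlerCoeff_eq (n q : ℕ) :
    mahlerCoeff n q = ∑ m ∈ Finset.range (q + 1), q.stirlingSecond m * (2 ^ q * oddDescSum n m) := by
  have h : ∀ l, (2 * l) ^ q =
      ∑ m ∈ Finset.range (q + 1), 2 ^ q * (q.stirlingSecond m * l.descFactorial m) := fun l => by
    rw [mul_pow, pow_eq_sum_stirlingSecond_mul_descFactorial l q, Finset.mul_sum]
  simp only [mahlerCoeff, oddDescSum, h, Finset.mul_sum]
  rw [Finset.sum_comm]
  exact Finset.sum_congr rfl fun m _ => Finset.sum_congr rfl fun l _ => by ring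

theorem two_pow_dvd_two_pow_mul_oddDescSum' {s δ m q : ℕ} (hδ : δ ≤ 1) (hmq : m ≤ q) :
    2 ^ (2 * 2 ^ s - 1 + δ + (q - m)) ∣ 2 ^ q * oddDescSum (2 * 2 ^ s + 1 + δ) m := by
  have h := mul_dvd_mul_left (2 ^ (q - m)) (two_pow_dvd_two_pow_mul_oddDescSum (s := s) hδ m)
  rwa [← mul_assoc, ← pow_add, ← pow_add, Nat.sub_add_cancel hmq, add_comm (q - m)] at h

theorem two_pow_dvd_mahlerCoeff {s δ : ℕ} (hδ : δ ≤ 1) (q : ℕ) :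
    2 ^ (2 * 2 ^ s - 1 + δ + (q - 2 ^ s)) ∣ mahlerCoeff (2 * 2 ^ s + 1 + δ) q := by
  rw [mahlerCoeff_eq]
  refine Finset.dvd_sum fun m hm => Dvd.dvd.mul_left ?_ _
  rw [Finset.mem_range] at hm
  rcases lt_or_ge (2 ^ s) m with h | h
  · rw [oddDescSum_eq_zero (by omega), mul_zero]
    exact dvd_zero _
  · exact (pow_dvd_pow 2 (by omega)).trans
      (two_pow_dvd_two_pow_mul_oddDescSum' (q := q) hδ (by omega))

/-- Terms with m < 2^s have a spare factor 2^(q-m); only m = q = 2^s, with Stirling number 1,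
attains the bound. -/
theorem exists_odd_mahlerCoeff {s δ : ℕ} (hs : 1 ≤ s) (hδ : δ ≤ 1) :
    ∃ u, Odd u ∧ mahlerCoeff (2 * 2 ^ s + 1 + δ) (2 ^ s) = 2 ^ (2 * 2 ^ s - 1 + δ) * u := by
  obtain ⟨u, hu, h⟩ := exists_odd_oddDescSum_self hs hδ
  have h1 : 2 ^ (2 * 2 ^ s - 1 + δ + 1) ∣ ∑ m ∈ Finset.range (2 ^ s),
      (2 ^ s).stirlingSecond m * (2 ^ (2 ^ s) * oddDescSum (2 * 2 ^ s + 1 + δ) m) := by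
    refine Finset.dvd_sum fun m hm => Dvd.dvd.mul_left ?_ _
    rw [Finset.mem_range] at hm
    exact (pow_dvd_pow 2 (by omega)).trans
      (two_pow_dvd_two_pow_mul_oddDescSum' (q := 2 ^ s) hδ hm.le)
  obtain ⟨w, hw⟩ := h1
  refine ⟨2 * w + u, (even_two_mul w).add_odd hu, ?_⟩
  rw [mahlerCoeff_eq, Finset.sum_range_succ, hw, Nat.stirlingSecond_self, one_mul, h, ← mul_assoc,
    ← pow_add, show 2 ^ s + (2 ^ s - 1 + δ) = 2 * 2 ^ s - 1 + δ by
      have := Nat.one_le_two_pow (n := s)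
      omega, pow_succ]
  ring

/-- The `r`-th forward difference of `k ↦ T_n(k)`. -/
def partialStirlingDiff (n k r : ℕ) : ℕ :=
  ∑ l ∈ Finset.range (n + 1), n.choose (2 * l + 1) * (2 * l + 1) ^ k * (2 * l) ^ r

theorem partialStirlingDiff_eq (n k r : ℕ) :
    partialStirlingDiff n k r = ∑ p ∈ Finset.range (k + 1), k.choose p * mahlerCoeff n (p + r) := by
  simp only [partialStirlingDiff, mahlerCoeff, add_pow, one_pow, mul_one, Finset.mul_sum,
    Finset.sum_mul]
  rw [Finset.sum_comm]
  exact Finset.sum_congr rfl fun m _ => Finset.sum_congr rfl fun l _ => by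
    simp only [Nat.cast_id]; ring

theorem natPartialStirling_add (n k H : ℕ) :
    natPartialStirling n (k + H) = natPartialStirling n k +
      ∑ r ∈ Finset.range H, H.choose (r + 1) * partialStirlingDiff n k (r + 1) := by
  have h : natPartialStirling n (k + H) =
      ∑ r ∈ Finset.range (H + 1), H.choose r * partialStirlingDiff n k r := by
    simp only [natPartialStirling, partialStirlingDiff, pow_add _ k H, add_pow _ _ H, one_pow,
      mul_one, Finset.mul_sum]
    rw [Finset.sum_comm]
    exact Finset.sum_congr rfl fun m _ => Finset.sum_congr rfl fun l _ => by
      simp only [Nat.cast_id]; ring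
  rw [h, Finset.sum_range_succ', add_comm]
  simp [partialStirlingDiff, natPartialStirling]

theorem two_pow_dvd_partialStirlingDiff {s δ : ℕ} (hδ : δ ≤ 1) (k r : ℕ) :
    2 ^ (2 * 2 ^ s - 1 + δ + (r - 2 ^ s)) ∣ partialStirlingDiff (2 * 2 ^ s + 1 + δ) k r := by
  rw [partialStirlingDiff_eq]
  exact Finset.dvd_sum fun p _ => Dvd.dvd.mul_left ((pow_dvd_pow 2 (by omega)).trans
    (two_pow_dvd_mahlerCoeff hδ (p + r))) _

theorem exists_odd_partialStirlingDiff {s δ : ℕ} (hs : 1 ≤ s) (hδ : δ ≤ 1) (k : ℕ) :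
    ∃ u, Odd u ∧
      partialStirlingDiff (2 * 2 ^ s + 1 + δ) k (2 ^ s) = 2 ^ (2 * 2 ^ s - 1 + δ) * u := by
  obtain ⟨u, hu, h⟩ := exists_odd_mahlerCoeff hs hδ
  have h1 : 2 ^ (2 * 2 ^ s - 1 + δ + 1) ∣ ∑ p ∈ Finset.range k,
      k.choose (p + 1) * mahlerCoeff (2 * 2 ^ s + 1 + δ) (p + 1 + 2 ^ s) :=
    Finset.dvd_sum fun p _ => Dvd.dvd.mul_left ((pow_dvd_pow 2 (by omega)).trans
      (two_pow_dvd_mahlerCoeff hδ (p + 1 + 2 ^ s))) _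
  obtain ⟨w, hw⟩ := h1
  refine ⟨2 * w + u, (even_two_mul w).add_odd hu, ?_⟩
  rw [partialStirlingDiff_eq, Finset.sum_range_succ', hw, zero_add, h, Nat.choose_zero_right,
    pow_succ]
  ring

/-! ### Powers of 2 in C(H, r) and the isometry property -/

/-- The last s binary digits of both entries are all 1; Lucas' theorem strips them one at a time. -/
theorem odd_choose_two_pow_mul_sub_one (s : ℕ) {h : ℕ} (hh : 1 ≤ h) :
    Odd ((2 ^ s * h - 1).choose (2 ^ s - 1)) := by
  induction s with
  | zero => simp
  | succ s ih =>
    have h1 := Choose.choose_modEq_choose_mod_mul_choose_div_nat (p := 2)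
      (n := 2 ^ (s + 1) * h - 1) (k := 2 ^ (s + 1) - 1)
    have h2 := Nat.one_le_two_pow (n := s)
    have h3 : 1 ≤ 2 ^ s * h := Nat.mul_pos h2 hh
    have h4 : 2 ^ (s + 1) * h = 2 * (2 ^ s * h) := by ring
    rw [show (2 ^ (s + 1) * h - 1) % 2 = 1 by omega, show (2 ^ (s + 1) * h - 1) / 2 = 2 ^ s * h - 1 by
      omega, show (2 ^ (s + 1) - 1) % 2 = 1 by omega, show (2 ^ (s + 1) - 1) / 2 = 2 ^ s - 1 by
      omega, Nat.choose_self, one_mul] at h1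
    rw [Nat.odd_iff] at ih ⊢
    exact Eq.trans h1 ih

theorem exists_odd_choose_two_pow_mul (s t : ℕ) {h : ℕ} (hh : Odd h) :
    ∃ u, Odd u ∧ (2 ^ s * (2 ^ t * h)).choose (2 ^ s) = 2 ^ t * u := by
  have h0 : 1 ≤ 2 ^ t * h := Nat.mul_pos Nat.one_le_two_pow hh.pos
  refine ⟨_, hh.mul (odd_choose_two_pow_mul_sub_one s h0), ?_⟩
  have h1 := Nat.add_one_mul_choose_eq (2 ^ s * (2 ^ t * h) - 1) (2 ^ s - 1)
  have h2 : 1 ≤ 2 ^ s := Nat.one_le_two_pow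
  rw [Nat.sub_add_cancel (Nat.mul_pos h2 h0), Nat.sub_add_cancel h2] at h1
  refine Nat.eq_of_mul_eq_mul_right h2 (h1.symm.trans ?_)
  ring

/-- From r C(H, r) = H C(H-1, r-1) the exponent of C(H, r) is at least s + t - ν(r), so it suffices
that ν(r) + 1 ≤ s + (r - 2^s), with truncated subtraction. This fails for r = 2^s, and also for s =
0, r = 2. -/
theorem two_pow_dvd_choose_mul {s t h r : ℕ} (hs : 1 ≤ s) (hr : 1 ≤ r) (hrs : r ≠ 2 ^ s) :
    2 ^ (t + 1) ∣ (2 ^ s * (2 ^ t * h)).choose r * 2 ^ (r - 2 ^ s) := by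
  obtain ⟨v, r', hr', rfl⟩ := Nat.exists_eq_two_pow_mul_odd (n := r) (by omega)
  set H := 2 ^ s * (2 ^ t * h) with hH
  rcases Nat.eq_zero_or_pos H with h0 | h0
  · rw [h0, Nat.choose_eq_zero_of_lt hr, zero_mul]
    exact dvd_zero _
  have h1 := Nat.add_one_mul_choose_eq (H - 1) (2 ^ v * r' - 1)
  rw [Nat.sub_add_cancel h0, Nat.sub_add_cancel hr] at h1
  have h2 : 2 ^ (s + t) ∣ 2 ^ v * H.choose (2 ^ v * r') := by
    refine (Nat.Coprime.pow_left _ (Nat.coprime_two_left.2 hr')).dvd_of_dvd_mul_right ?_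
    refine ⟨h * (H - 1).choose (2 ^ v * r' - 1), ?_⟩
    calc _ = H.choose (2 ^ v * r') * (2 ^ v * r') := by ring
      _ = _ := by rw [← h1, hH]; ring
  have hle : v + 1 ≤ s + (2 ^ v * r' - 2 ^ s) := by
    rcases lt_or_ge v s with hv | hv
    · omega
    · have hlt : v < 2 ^ v := Nat.lt_two_pow_self
      have hle' : 2 ^ s ≤ 2 ^ v := Nat.pow_le_pow_right (by norm_num) hv
      have hr1 := hr'.pos
      rcases Nat.lt_or_ge r' 2 with h' | h'
      · obtain rfl : r' = 1 := by omega
        rw [mul_one] at hrs ⊢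
        have hsv : s + 1 ≤ v := by
          rcases Nat.lt_or_ge s v with h'' | h''
          · exact h''
          · exact absurd (by rw [le_antisymm h'' hv]) hrs
        have h5 : 2 ^ s * 2 ≤ 2 ^ v := by
          rw [← pow_succ]
          exact Nat.pow_le_pow_right (by norm_num) hsv
        obtain ⟨w, rfl⟩ : ∃ w, v = w + 1 := ⟨v - 1, by omega⟩
        have h6 : w < 2 ^ w := Nat.lt_two_pow_self
        rw [pow_succ] at h5 ⊢
        omega
      · have : 2 ^ v * 2 ≤ 2 ^ v * r' := Nat.mul_le_mul_left _ h'
        omega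
  have h3 : 2 ^ v * 2 ^ (t + 1) ∣
      2 ^ v * (H.choose (2 ^ v * r') * 2 ^ (2 ^ v * r' - 2 ^ s)) := by
    rw [← mul_assoc, ← pow_add]
    refine (pow_dvd_pow 2 ?_).trans (by
      rw [pow_add]
      exact mul_dvd_mul_right h2 (2 ^ (2 ^ v * r' - 2 ^ s)))
    omega
  exact Nat.dvd_of_mul_dvd_mul_left (by positivity) h3

/-- The 2-adic exponent of a difference of values of `T_n`. -/
theorem exists_odd_natPartialStirling_add {s δ t h : ℕ} (hs : 1 ≤ s) (hδ : δ ≤ 1) (hh : Odd h)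
    (k : ℕ) :
    ∃ u, Odd u ∧ natPartialStirling (2 * 2 ^ s + 1 + δ) (k + 2 ^ s * (2 ^ t * h)) =
      natPartialStirling (2 * 2 ^ s + 1 + δ) k + 2 ^ (2 * 2 ^ s - 1 + δ) * (2 ^ t * u) := by
  obtain ⟨u, hu, h1⟩ := exists_odd_partialStirlingDiff hs hδ k
  obtain ⟨c, hc, h2⟩ := exists_odd_choose_two_pow_mul s t hh
  set H := 2 ^ s * (2 ^ t * h) with hH
  have hM : 1 ≤ 2 ^ s := Nat.one_le_two_pow
  have hmem : 2 ^ s - 1 ∈ Finset.range H := by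
    have : 2 ^ s * 1 ≤ H := Nat.mul_le_mul_left _ (Nat.mul_pos Nat.one_le_two_pow hh.pos)
    rw [Finset.mem_range]
    omega
  -- Index 2^s - 1 is the difference of order 2^s, the only term of minimal exponent.
  rw [natPartialStirling_add, ← Finset.add_sum_erase _ _ hmem, Nat.sub_add_cancel hM, h1, h2]
  have h3 : 2 ^ (2 * 2 ^ s - 1 + δ) * 2 ^ (t + 1) ∣ ∑ r ∈ (Finset.range H).erase (2 ^ s - 1),
      H.choose (r + 1) * partialStirlingDiff (2 * 2 ^ s + 1 + δ) k (r + 1) := by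
    refine Finset.dvd_sum fun r hr => ?_
    obtain ⟨d, hd⟩ := two_pow_dvd_partialStirlingDiff (s := s) hδ k (r + 1)
    have h4 := two_pow_dvd_choose_mul (t := t) (h := h) hs (Nat.succ_pos r)
      (fun h => (Finset.mem_erase.1 hr).1 (by omega))
    rw [← hH] at h4
    rw [hd, pow_add 2 (2 * 2 ^ s - 1 + δ), show H.choose (r + 1) * (2 ^ (2 * 2 ^ s - 1 + δ) * 2 ^ (r + 1 - 2 ^ s) * d) =
      2 ^ (2 * 2 ^ s - 1 + δ) * (H.choose (r + 1) * 2 ^ (r + 1 - 2 ^ s)) * d by ring]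
    exact Dvd.dvd.mul_right (mul_dvd_mul_left _ h4) _
  obtain ⟨w, hw⟩ := h3
  refine ⟨c * u + 2 * w, (hc.mul hu).add_even (even_two_mul w), ?_⟩
  rw [hw, pow_succ]
  ring

/-! ### Stirling numbers modulo 4 by generating functions -/

section StirlingModFour

open PowerSeries

/-- The generating function of the Stirling numbers `S(m + d, m)` modulo `4`. -/
noncomputable def stirlingSeries (m : ℕ) : (ZMod 4)⟦X⟧ :=
  PowerSeries.mk fun d => ((m + d).stirlingSecond m : ZMod 4)

theorem stirlingSeries_zero : stirlingSeries 0 = 1 := by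
  ext d
  rw [stirlingSeries, coeff_mk, coeff_one]
  cases d <;> simp

/-- The Stirling recurrence; iterated, it says that `stirlingSeries m` is ∏_{j ≤ m} 1/(1 - jX). -/
theorem one_sub_mul_stirlingSeries (m : ℕ) :
    (1 - ((m + 1 : ℕ) : (ZMod 4)⟦X⟧) * X) * stirlingSeries (m + 1) = stirlingSeries m := by
  rw [sub_mul, one_mul, mul_assoc, ← nsmul_eq_mul]
  ext d
  rw [map_sub, map_nsmul, stirlingSeries, stirlingSeries, coeff_mk, coeff_mk]
  cases d with
  | zero => simp [Nat.stirlingSecond_self]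
  | succ d =>
    rw [coeff_succ_X_mul, coeff_mk, show m + 1 + (d + 1) = m + 1 + d + 1 by ring,
      Nat.stirlingSecond_succ_succ, show m + (d + 1) = m + 1 + d by ring]
    push_cast
    rw [nsmul_eq_mul]
    push_cast
    ring

/-- Eight consecutive factors 1 - jX run twice through the residues modulo 4, where (1-X)(1-3X) = 1
- X² and (1-2X)² = 1. -/
theorem stirlingSeries_eq_mul_add_eight (t : ℕ) :
    stirlingSeries (8 * t) = (1 - X ^ 2) ^ 2 * stirlingSeries (8 * (t + 1)) := by
  have h4 : (4 : (ZMod 4)⟦X⟧) = 0 := by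
    have : ((4 : ℕ) : ZMod 4) = 0 := by decide
    rw [show (4 : (ZMod 4)⟦X⟧) = ((4 : ℕ) : (ZMod 4)⟦X⟧) by norm_num,
      ← map_natCast (PowerSeries.C (R := ZMod 4)), this, map_zero]
  have hc : ∀ j c : ℕ, c < 4 → j % 4 = c → ((8 * t + j : ℕ) : (ZMod 4)⟦X⟧) = c := by
    intro j c _ hj
    have := Nat.div_add_mod (8 * t + j) 4
    rw [show (8 * t + j) % 4 = c by omega] at this
    rw [← this]
    push_cast
    rw [h4, zero_mul, zero_add]
  have ha : (1 - X : (ZMod 4)⟦X⟧) * (1 - 3 * X) = 1 - X ^ 2 := by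
    linear_combination (X ^ 2 - X) * h4
  have hb : (1 - 2 * X : (ZMod 4)⟦X⟧) ^ 2 = 1 := by
    linear_combination (X ^ 2 - X) * h4
  have h := fun j => one_sub_mul_stirlingSeries (8 * t + j)
  have h0 := h 0
  have h1 := h 1
  have h2 := h 2
  have h3 := h 3
  have h5 := h 4
  have h6 := h 5
  have h7 := h 6
  have h8 := h 7
  simp only [add_assoc, add_zero, Nat.reduceAdd] at h0 h1 h2 h3 h5 h6 h7 h8
  rw [hc 1 1 (by norm_num) rfl] at h0
  rw [hc 2 2 (by norm_num) rfl] at h1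
  rw [hc 3 3 (by norm_num) rfl] at h2
  rw [hc 4 0 (by norm_num) rfl] at h3
  rw [hc 5 1 (by norm_num) rfl] at h5
  rw [hc 6 2 (by norm_num) rfl] at h6
  rw [hc 7 3 (by norm_num) rfl] at h7
  rw [hc 8 0 (by norm_num) rfl] at h8
  rw [← h0, ← h1, ← h2, ← h3, ← h5, ← h6, ← h7, ← h8, show 8 * (t + 1) = 8 * t + 8 by ring, ← ha]
  push_cast
  linear_combination (((1 - X) * (1 - 3 * X)) ^ 2 * stirlingSeries (8 * t + 8)) * hb

theorem pow_mul_stirlingSeries (t : ℕ) :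
    (1 - X ^ 2) ^ (2 * t) * stirlingSeries (8 * t) = 1 := by
  induction t with
  | zero => simpa using stirlingSeries_zero
  | succ t ih =>
    rw [stirlingSeries_eq_mul_add_eight t] at ih
    rw [show 2 * (t + 1) = 2 * t + 2 by ring, pow_add, mul_assoc, ih]

/-- The power series with coefficients `(r + ⌊d/2⌋ choose r)`. -/
noncomputable def chooseHalfSeries (r : ℕ) : (ZMod 4)⟦X⟧ :=
  PowerSeries.mk fun d => ((r + d / 2).choose r : ZMod 4)

theorem one_sub_sq_mul_chooseHalfSeries (r : ℕ) :
    (1 - X ^ 2) * chooseHalfSeries (r + 1) = chooseHalfSeries r := by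
  rw [sub_mul, one_mul]
  ext d
  rw [map_sub, chooseHalfSeries, chooseHalfSeries, coeff_X_pow_mul', coeff_mk, coeff_mk]
  split_ifs with hd
  · obtain ⟨d, rfl⟩ := Nat.exists_eq_add_of_le' hd
    rw [coeff_mk, Nat.add_sub_cancel, show r + 1 + (d + 2) / 2 = r + 1 + d / 2 + 1 by omega,
      Nat.choose_succ_succ, show r + (d + 2) / 2 = r + 1 + d / 2 by omega]
    push_cast
    ring
  · have hd0 : d / 2 = 0 := by omega
    simp [hd0]

theorem pow_mul_chooseHalfSeries (r : ℕ) :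
    (1 - X) * (1 - X ^ 2) ^ r * chooseHalfSeries r = 1 := by
  induction r with
  | zero =>
    ext d
    rw [pow_zero, mul_one, sub_mul, one_mul, map_sub, chooseHalfSeries, coeff_mk, coeff_one]
    cases d <;> simp
  | succ r ih => rw [pow_succ, ← mul_assoc, mul_assoc _ (1 - X ^ 2),
      one_sub_sq_mul_chooseHalfSeries, ih]

theorem stirlingSecond_modEq_four (t d : ℕ) :
    (8 * t + 1 + d).stirlingSecond (8 * t + 1) ≡ (2 * t + d / 2).choose (2 * t) [MOD 4] := by
  have h8 : ((8 * t + 1 : ℕ) : (ZMod 4)⟦X⟧) = 1 := by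
    have : ((8 * t + 1 : ℕ) : ZMod 4) = 1 := by
      push_cast
      rw [show (8 : ZMod 4) = 0 by decide, zero_mul, zero_add]
    rw [← map_natCast (PowerSeries.C (R := ZMod 4)), this, map_one]
  have h1 := one_sub_mul_stirlingSeries (8 * t)
  rw [h8, one_mul] at h1
  have h2 := pow_mul_stirlingSeries t
  rw [← h1] at h2
  have h3 := pow_mul_chooseHalfSeries (2 * t)
  -- Both series are inverse to (1-X)(1-X²)^(2t).
  have h4 : stirlingSeries (8 * t + 1) = chooseHalfSeries (2 * t) := by
    linear_combination chooseHalfSeries (2 * t) * h2 - stirlingSeries (8 * t + 1) * h3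
  have h5 := congrArg (coeff d) h4
  rw [stirlingSeries, chooseHalfSeries, coeff_mk, coeff_mk] at h5
  exact (ZMod.natCast_eq_natCast_iff _ _ _).1 h5

end StirlingModFour

/-! ### Carries, and the residues of S(2^s+i, 2^s) and S(2^s+i, 2^s+1) -/

theorem odd_of_padicValNat_two_eq_zero {n : ℕ} (hn : n ≠ 0) (h : padicValNat 2 n = 0) : Odd n := by
  rw [← Nat.not_even_iff_odd, even_iff_two_dvd]
  intro h2
  have := one_le_padicValNat_of_dvd hn h2
  omega

/-- Kummer: adding q and 2^a in binary produces no carry. -/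
theorem odd_choose_two_pow_add_of_lt {a q : ℕ} (h : q < 2 ^ a) : Odd ((q + 2 ^ a).choose (2 ^ a)) := by
  refine odd_of_padicValNat_two_eq_zero (Nat.choose_pos (Nat.le_add_left _ _)).ne' ?_
  rw [padicValNat_choose' (Nat.lt_succ_self _), Finset.card_eq_zero, Finset.filter_eq_empty_iff]
  intro i _
  rw [not_le]
  rcases le_or_gt i a with hi | hi
  · rw [Nat.mod_eq_zero_of_dvd (pow_dvd_pow 2 hi), zero_add]
    exact Nat.mod_lt _ (by positivity)
  · have h1 : 2 ^ (a + 1) ≤ 2 ^ i := Nat.pow_le_pow_right (by norm_num) hi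
    have h2 := Nat.mod_le (2 ^ a) (2 ^ i)
    have h3 := Nat.mod_le q (2 ^ i)
    rw [pow_succ] at h1
    omega

theorem odd_choose_two_pow_add_two_mul (a : ℕ) :
    Odd ((2 * 2 ^ a + 2 ^ a).choose (2 ^ a)) := by
  refine odd_of_padicValNat_two_eq_zero (Nat.choose_pos (Nat.le_add_left _ _)).ne' ?_
  rw [padicValNat_choose' (Nat.lt_succ_self _), Finset.card_eq_zero, Finset.filter_eq_empty_iff]
  intro i _
  rw [not_le]
  have h0 : 0 < 2 ^ a := by positivity
  rcases le_or_gt i (a + 1) with hi | hi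
  · rw [← pow_succ', Nat.mod_eq_zero_of_dvd (pow_dvd_pow 2 hi), add_zero]
    exact Nat.mod_lt _ (by positivity)
  · have h1 : 2 ^ (a + 1 + 1) ≤ 2 ^ i := Nat.pow_le_pow_right (by norm_num) hi
    have h2 := Nat.mod_le (2 ^ a) (2 ^ i)
    have h3 := Nat.mod_le (2 * 2 ^ a) (2 ^ i)
    rw [pow_succ, pow_succ] at h1
    omega

/-- Kummer: bit a of q is set and is its top bit, so there is exactly one carry, out of position a.
-/
theorem choose_two_pow_add_mod_four {a q : ℕ} (h : 2 ^ a ≤ q) (h' : q < 2 * 2 ^ a) :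
    (q + 2 ^ a).choose (2 ^ a) % 4 = 2 := by
  have h0 : 0 < 2 ^ a := by positivity
  have hlog : a + 1 ≤ Nat.log 2 (q + 2 ^ a) :=
    Nat.le_log_of_pow_le (by norm_num) (by rw [pow_succ]; omega)
  have hval : padicValNat 2 ((q + 2 ^ a).choose (2 ^ a)) = 1 := by
    rw [padicValNat_choose' (Nat.lt_succ_self _), Finset.card_eq_one]
    refine ⟨a + 1, ?_⟩
    ext i
    rw [Finset.mem_filter, Finset.mem_Ico, Finset.mem_singleton]
    constructor
    · rintro ⟨-, hi⟩
      by_contra hne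
      revert hi
      rw [imp_false, not_le]
      rcases lt_or_gt_of_ne hne with hi | hi
      · rw [Nat.mod_eq_zero_of_dvd (pow_dvd_pow 2 (by omega : i ≤ a)), zero_add]
        exact Nat.mod_lt _ (by positivity)
      · have h1 : 2 ^ (a + 1 + 1) ≤ 2 ^ i := Nat.pow_le_pow_right (by norm_num) hi
        have h2 := Nat.mod_le (2 ^ a) (2 ^ i)
        have h3 := Nat.mod_le q (2 ^ i)
        rw [pow_succ, pow_succ] at h1
        omega
    · rintro rfl
      refine ⟨by omega, ?_⟩
      rw [pow_succ, Nat.mod_eq_of_lt (by omega : 2 ^ a < 2 ^ a * 2),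
        Nat.mod_eq_of_lt (by omega : q < 2 ^ a * 2)]
      omega
  have hne := (Nat.choose_pos (Nat.le_add_left (2 ^ a) q)).ne'
  have h1 : 2 ∣ (q + 2 ^ a).choose (2 ^ a) := dvd_of_one_le_padicValNat hval.ge
  have h2 : ¬ 4 ∣ (q + 2 ^ a).choose (2 ^ a) := by
    intro h4
    have := (padicValNat_dvd_iff_le (p := 2) hne (n := 2)).1 (by simpa using h4)
    omega
  omega

theorem stirlingSecond_two_pow_modEq {s i : ℕ} (hs : 3 ≤ s) (hi : 1 ≤ i) :
    (2 ^ s + i).stirlingSecond (2 ^ s + 1) ≡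
      ((i - 1) / 2 + 2 ^ (s - 2)).choose (2 ^ (s - 2)) [MOD 4] := by
  obtain ⟨s, rfl⟩ := Nat.exists_eq_add_of_le' hs
  have h := stirlingSecond_modEq_four (2 ^ s) (i - 1)
  rw [show 8 * 2 ^ s + 1 + (i - 1) = 2 ^ (s + 3) + i by rw [pow_add]; omega,
    show 8 * 2 ^ s + 1 = 2 ^ (s + 3) + 1 by rw [pow_add]; omega, ← pow_succ', add_comm (2 ^ (s + 1))] at h
  exact h

theorem odd_stirlingSecond_two_pow_add_one {s i : ℕ} (hs : 1 ≤ s) (hi : 1 ≤ i)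
    (hi' : i ≤ 2 ^ (s - 1)) : Odd ((2 ^ s + i).stirlingSecond (2 ^ s + 1)) := by
  rcases Nat.lt_or_ge s 3 with h | h
  · interval_cases s <;> simp only [Nat.reduceSub, Nat.reducePow] at hi' ⊢ <;> interval_cases i <;>
      decide
  · have h1 := stirlingSecond_two_pow_modEq h hi
    obtain ⟨s, rfl⟩ := Nat.exists_eq_add_of_le' (by omega : 2 ≤ s)
    have h2 := odd_choose_two_pow_add_of_lt (a := s) (q := (i - 1) / 2) (by
      rw [show s + 2 - 1 = s + 1 by omega, pow_succ] at hi'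
      omega)
    rw [Nat.add_sub_cancel, Nat.ModEq] at h1
    rw [Nat.odd_iff] at h2 ⊢
    omega

theorem stirlingSecond_two_pow_add_one_mod_four {s i : ℕ} (hs : 1 ≤ s) (hi : 2 ^ (s - 1) < i)
    (hi' : i ≤ 2 ^ s) (hne : ¬ (s = 2 ∧ i = 3)) :
    (2 ^ s + i).stirlingSecond (2 ^ s + 1) % 4 = 2 := by
  rcases Nat.lt_or_ge s 3 with h | h
  · interval_cases s <;> simp only [Nat.reduceSub, Nat.reducePow] at hi hi' ⊢ <;>
      interval_cases i <;> first | decide | simp at hne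
  · have h1 := stirlingSecond_two_pow_modEq h (Nat.one_le_of_lt hi)
    obtain ⟨s, rfl⟩ := Nat.exists_eq_add_of_le' (by omega : 2 ≤ s)
    rw [show s + 2 - 1 = s + 1 by omega] at hi
    rw [pow_succ] at hi hi'
    rw [pow_succ] at hi'
    have h2 := choose_two_pow_add_mod_four (a := s) (q := (i - 1) / 2) (by omega) (by omega)
    rw [Nat.add_sub_cancel, Nat.ModEq] at h1
    omega

/-- Modulo 2 the recurrence makes S(2^s+i, 2^s) the difference of S(2^s+j, 2^s+1) at j = i and j = i
+ 1. These are odd, even, odd according to q = ⌊(j-1)/2⌋ < 2^(s-2), then q < 2^(s-1), then q =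
2^(s-1), so the parity flips at exactly two values of i. -/
theorem odd_stirlingSecond_two_pow_iff {s i : ℕ} (hs : 1 ≤ s) (hi : 1 ≤ i) (hi' : i ≤ 2 ^ s) :
    Odd ((2 ^ s + i).stirlingSecond (2 ^ s)) ↔ i = 2 ^ (s - 1) ∨ i = 2 ^ s := by
  rcases Nat.lt_or_ge s 3 with h | h
  · interval_cases s <;> simp only [Nat.reduceSub, Nat.reducePow] at hi' ⊢ <;> interval_cases i <;>
      decide
  · have h1 := stirlingSecond_two_pow_modEq h hi
    have h2 := stirlingSecond_two_pow_modEq h (by omega : 1 ≤ i + 1)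
    have h3 := Nat.stirlingSecond_succ_succ (2 ^ s + i) (2 ^ s)
    rw [add_assoc] at h3
    have h4 : Odd (2 ^ s + 1) := odd_two_pow_add_one hs
    have h5 : Odd ((2 ^ s + (i + 1)).stirlingSecond (2 ^ s + 1)) ↔
        (Odd ((2 ^ s + i).stirlingSecond (2 ^ s + 1)) ↔
          ¬ Odd ((2 ^ s + i).stirlingSecond (2 ^ s))) := by
      rw [h3, Nat.odd_add, Nat.odd_mul, Nat.not_odd_iff_even]
      simp only [h4, true_and]
    have key : ∀ j, Odd ((2 ^ s + j).stirlingSecond (2 ^ s + 1)) ↔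
        (2 ^ s + j).stirlingSecond (2 ^ s + 1) % 4 % 2 = 1 := fun j => by
      rw [Nat.odd_iff]; omega
    rw [key, key, h1, h2] at h5
    obtain ⟨s, rfl⟩ := Nat.exists_eq_add_of_le' (by omega : 2 ≤ s)
    rw [Nat.add_sub_cancel, Nat.add_sub_cancel] at h5
    rw [show s + 2 - 1 = s + 1 by omega]
    have hp : 2 ^ (s + 2) = 4 * 2 ^ s := by rw [pow_add]; omega
    have hp' : 2 ^ (s + 1) = 2 * 2 ^ s := by rw [pow_add]; omega
    have hA : ∀ q, q ≤ 2 * 2 ^ s →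
        ((q + 2 ^ s).choose (2 ^ s) % 4 % 2 = 1 ↔ q < 2 ^ s ∨ q = 2 * 2 ^ s) := by
      intro q hq
      rcases lt_or_ge q (2 ^ s) with hq' | hq'
      · have := Nat.odd_iff.1 (odd_choose_two_pow_add_of_lt hq')
        omega
      · rcases hq.lt_or_eq with hlt | rfl
        · have := choose_two_pow_add_mod_four hq' hlt
          omega
        · have := Nat.odd_iff.1 (odd_choose_two_pow_add_two_mul s)
          omega
    rw [hA _ (by omega), hA _ (by omega)] at h5
    have h0 : 0 < 2 ^ s := by positivity
    by_cases ho : Odd ((2 ^ (s + 2) + i).stirlingSecond (2 ^ (s + 2)))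
    · simp only [ho, not_true_eq_false, iff_false, true_iff] at h5 ⊢
      omega
    · simp only [ho, not_false_eq_true, iff_true, false_iff] at h5 ⊢
      omega

/-! ### The value of T_n at 2^s + i -/

/-- `T_n(M + i)` for `n = 2M + 1`, where `M = 2 ^ s`. -/
theorem exists_natPartialStirling_two_mul_add_one {s i : ℕ} (hi : 1 ≤ i) (hi' : i ≤ 2 ^ s) :
    ∃ u w, Odd u ∧ natPartialStirling (2 * 2 ^ s + 1) (2 ^ s + i) =
      2 ^ (2 * 2 ^ s - 1) * (2 ^ i * ((2 ^ s + i).stirlingSecond (2 ^ s) * u + 2 * w)) := by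
  obtain ⟨u, hu, hfac⟩ := exists_odd_factorial_two_pow s
  have h1 := natPartialStirling_succ_of_lt (N := 2 * 2 ^ s) (k := 2 ^ s + i - 1) (by omega)
  have h0 : 1 ≤ 2 ^ s := Nat.one_le_two_pow
  rw [Nat.sub_add_cancel (by omega : 1 ≤ 2 ^ s + i)] at h1
  -- The local `M` is 2^s - 1, the last m for which `oddDescSum (2 * 2 ^ s) m` is nonzero.
  obtain ⟨M, hM⟩ : ∃ M, 2 ^ s = M + 1 := ⟨2 ^ s - 1, by omega⟩
  have h2 : ∑ m ∈ Finset.range (2 ^ s + i),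
      (2 ^ s + i).stirlingSecond (m + 1) * oddDescSum (2 * 2 ^ s) m =
      ∑ m ∈ Finset.range (M + 1),
        (2 ^ s + i).stirlingSecond (m + 1) * oddDescSum (2 * 2 ^ s) m := by
    symm
    refine Finset.sum_subset (Finset.range_subset_range.2 (by omega)) fun m _ hm => ?_
    rw [Finset.mem_range] at hm
    rw [oddDescSum_eq_zero (by omega), mul_zero]
  have h3 : 2 ^ (2 ^ s + 1) ∣ ∑ m ∈ Finset.range M,
      (2 ^ s + i).stirlingSecond (m + 1) * oddDescSum (2 * 2 ^ s) m := by
    refine Finset.dvd_sum fun m hm => Dvd.dvd.mul_left ?_ _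
    rw [Finset.mem_range] at hm
    exact (pow_dvd_pow 2 (by omega)).trans
      (two_pow_dvd_oddDescSum_two_mul (s := s) (a := 2 ^ s - 1 - m) (by omega))
  obtain ⟨w, hw⟩ := h3
  have h4 : oddDescSum (2 * 2 ^ s) M = 2 ^ (2 ^ s) * u := by
    rw [show 2 * 2 ^ s = 2 * M + 2 by omega, oddDescSum_two_mul_add_two_self, ← hM, hfac,
      ← Nat.sub_add_cancel h0, pow_succ, Nat.sub_add_cancel h0]
    ring
  refine ⟨(2 * 2 ^ s + 1) * u, (2 * 2 ^ s + 1) * w, (odd_two_mul_add_one _).mul hu, ?_⟩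
  rw [h1, h2, Finset.sum_range_succ, hw, h4, ← hM, pow_succ 2 (2 ^ s)]
  have h5 : 2 ^ (2 ^ s + i - 1) * 2 ^ (2 ^ s) = 2 ^ (2 * 2 ^ s - 1) * 2 ^ i := by
    rw [← pow_add, ← pow_add]; congr 1; omega
  linear_combination (2 * 2 ^ s + 1) * (2 * w + (2 ^ s + i).stirlingSecond (2 ^ s) * u) * h5

/-- `T_n(M + i)` for `n = 2M + 2`, where `M = 2 ^ s`. -/
theorem exists_natPartialStirling_two_mul_add_two {s i : ℕ} (hs : 1 ≤ s) (hi : 1 ≤ i)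
    (hi' : i ≤ 2 ^ s) :
    ∃ u v w, Odd u ∧ Odd v ∧ natPartialStirling (2 * 2 ^ s + 2) (2 ^ s + i) =
      2 ^ (2 * 2 ^ s) * (2 ^ (i - 1) * ((2 ^ s + i).stirlingSecond (2 ^ s + 1) * u +
        2 * ((2 ^ s + i).stirlingSecond (2 ^ s) * v) + 4 * w)) := by
  obtain ⟨u, hu, hfac⟩ := exists_odd_factorial_two_pow s
  have h1 := natPartialStirling_succ_of_lt (N := 2 * 2 ^ s + 1) (k := 2 ^ s + i - 1) (by omega)
  have h0 : 1 ≤ 2 ^ s := Nat.one_le_two_pow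
  rw [Nat.sub_add_cancel (by omega : 1 ≤ 2 ^ s + i)] at h1
  obtain ⟨M, hM⟩ : ∃ M, 2 ^ s = M + 1 := ⟨2 ^ s - 1, by omega⟩
  have h2 : ∑ m ∈ Finset.range (2 ^ s + i),
      (2 ^ s + i).stirlingSecond (m + 1) * oddDescSum (2 * 2 ^ s + 1) m =
      ∑ m ∈ Finset.range (M + 1 + 1),
        (2 ^ s + i).stirlingSecond (m + 1) * oddDescSum (2 * 2 ^ s + 1) m := by
    symm
    refine Finset.sum_subset (Finset.range_subset_range.2 (by omega)) fun m _ hm => ?_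
    rw [Finset.mem_range] at hm
    rw [oddDescSum_eq_zero (by omega), mul_zero]
  -- Modulo 4 relative to 2^(2^s - 1), only the two top terms m = 2^s - 1 and m = 2^s survive.
  have h3 : 2 ^ (2 ^ s - 1 + 2) ∣ ∑ m ∈ Finset.range M,
      (2 ^ s + i).stirlingSecond (m + 1) * oddDescSum (2 * 2 ^ s + 1) m := by
    refine Finset.dvd_sum fun m hm => Dvd.dvd.mul_left ?_ _
    rw [Finset.mem_range] at hm
    exact (pow_dvd_pow 2 (by omega)).trans
      (two_pow_dvd_oddDescSum (s := s) (δ := 0) (a := 2 ^ s - m) (by omega) (by omega))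
  obtain ⟨w, hw⟩ := h3
  have h4 : oddDescSum (2 * 2 ^ s + 1) M = 2 ^ (2 ^ s - 1) * (2 * ((2 ^ s + 1) * u)) := by
    rw [show 2 * 2 ^ s + 1 = 2 * M + 3 by omega, oddDescSum_two_mul_add_three_self,
      show M + 2 = 2 ^ s + 1 by omega, Nat.factorial_succ, hfac]
    ring
  have hodd := odd_two_pow_add_one hs
  refine ⟨(2 ^ s + 1) * u, (2 ^ s + 1) * ((2 ^ s + 1) * u), (2 ^ s + 1) * w, hodd.mul hu,
    hodd.mul (hodd.mul hu), ?_⟩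
  rw [h1, h2, Finset.sum_range_succ, Finset.sum_range_succ, hw, h4, ← hM,
    oddDescSum_two_mul_add_one_self, hfac, pow_add 2 (2 ^ s - 1)]
  have h5 : 2 * 2 ^ (2 ^ s + i - 1) * 2 ^ (2 ^ s - 1) = 2 ^ (2 * 2 ^ s) * 2 ^ (i - 1) := by
    rw [← pow_succ', ← pow_add, ← pow_add]; congr 1; omega
  linear_combination (2 ^ s + 1) * (4 * w + (2 ^ s + i).stirlingSecond (2 ^ s) *
    (2 * ((2 ^ s + 1) * u)) + (2 ^ s + i).stirlingSecond (2 ^ s + 1) * u) * h5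

/-! ### The 2-adic zero of an isometry -/

open Filter Topology in
/-- A function on the integers that preserves 2-adic distances and has no integer zero has a 2-adic
zero, whose binary expansion is found greedily. -/
theorem exists_padicInt_zero_of_isometry {F : ℤ → ℤ_[2]} (h0 : ∀ x, F x ≠ 0)
    (hF : ∀ x y, ‖F x - F y‖ = ‖(x : ℤ_[2]) - y‖) :
    ∃ ξ : ℤ_[2], (∀ x : ℤ, ‖F x‖ = ‖(x : ℤ_[2]) - ξ‖) ∧
      ∃ t : ℕ → ℕ, StrictMono t ∧ (t 0 = (F 0).valuation) ∧
        (∀ j, t (j + 1) = (F (∑ l ∈ Finset.range (j + 1), 2 ^ t l)).valuation) ∧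
        HasSum (fun j => (2 : ℤ_[2]) ^ t j) ξ := by
  let y : ℕ → ℤ := fun j => Nat.rec 0 (fun _ z => z + 2 ^ (F z).valuation) j
  let t : ℕ → ℕ := fun j => (F (y j)).valuation
  have hy : ∀ j, y (j + 1) = y j + 2 ^ t j := fun _ => rfl
  have hsum : ∀ j, y j = ∑ l ∈ Finset.range j, 2 ^ t l := by
    intro j
    induction j with
    | zero => rfl
    | succ j ih => rw [hy, Finset.sum_range_succ, ← ih]
  have hunit : ∀ z : ℤ_[2], ‖z‖ = 1 → (2 : ℤ_[2]) ∣ z - 1 := by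
    intro z hz
    obtain ⟨m, hm, h⟩ := PadicInt.exists_mem_range (p := 2) z
    rw [PadicInt.maximalIdeal_eq_span_p, Ideal.mem_span_singleton] at h
    interval_cases m
    · rw [Nat.cast_zero, sub_zero] at h
      have := (PadicInt.norm_lt_one_iff_dvd z).2 h
      rw [hz] at this
      exact absurd this (lt_irrefl _)
    · simpa using h
  have hnorm : ∀ j, ‖F (y j)‖ = (2 : ℝ) ^ (-(t j : ℤ)) := fun j => by
    rw [PadicInt.norm_eq_zpow_neg_valuation (h0 _)]; norm_num [t]
  have hquot : ∀ (z : ℤ_[2]) (k : ℕ), ‖z‖ = (2 : ℝ) ^ (-(k : ℤ)) → ∃ a, ‖a‖ = 1 ∧ z = 2 ^ k * a := by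
    intro z k hz
    have h1 : z ∈ Ideal.span {((2 : ℕ) : ℤ_[2]) ^ k} :=
      (PadicInt.norm_le_pow_iff_mem_span_pow z k).1 (by rw [hz]; norm_num)
    rw [Ideal.mem_span_singleton] at h1
    obtain ⟨a, rfl⟩ := h1
    refine ⟨a, ?_, by norm_num⟩
    rw [norm_mul, PadicInt.norm_p_pow, Nat.cast_ofNat] at hz
    exact (mul_eq_left₀ (by positivity)).1 hz
  -- F(y_j) and F(y_{j+1}) - F(y_j) are both 2^(t_j) times a unit; units are odd, so their sum is
  -- divisible by 2^(t_j + 1).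
  have hmono : StrictMono t := by
    refine strictMono_nat_of_lt_succ fun j => ?_
    obtain ⟨a, ha, hya⟩ := hquot _ _ (hnorm j)
    have hd : ‖F (y (j + 1)) - F (y j)‖ = (2 : ℝ) ^ (-(t j : ℤ)) := by
      rw [hF, hy]
      have := PadicInt.norm_p_pow (p := 2) (t j)
      push_cast at this ⊢
      rw [add_sub_cancel_left, this]
    obtain ⟨b, hb, hyb⟩ := hquot _ _ hd
    obtain ⟨a', ha'⟩ := hunit a ha
    obtain ⟨b', hb'⟩ := hunit b hb
    have h1 : F (y (j + 1)) = ((2 : ℕ) : ℤ_[2]) ^ (t j + 1) * (a' + b' + 1) := by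
      rw [Nat.cast_ofNat, pow_succ]
      linear_combination hyb + hya + 2 ^ t j * (ha' + hb')
    have h2 := (PadicInt.mem_span_pow_iff_le_valuation _ (h0 (y (j + 1))) (t j + 1)).1
      (Ideal.mem_span_singleton.2 ⟨_, h1⟩)
    exact h2
  have hpow : ∀ j, ‖(2 : ℤ_[2]) ^ t j‖ ≤ (1 / 2 : ℝ) ^ j := by
    intro j
    have h1 := PadicInt.norm_p_pow (p := 2) (t j)
    rw [Nat.cast_ofNat, Nat.cast_ofNat] at h1
    rw [h1, zpow_neg, zpow_natCast, ← inv_pow, one_div]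
    exact pow_le_pow_of_le_one (by norm_num) (by norm_num) hmono.le_apply
  have hs : Summable fun j => (2 : ℤ_[2]) ^ t j :=
    Summable.of_norm_bounded (summable_geometric_of_lt_one (by norm_num) (by norm_num)) hpow
  have hlim : Tendsto (fun j => (Int.cast (y j) : ℤ_[2])) atTop (𝓝 (∑' j, (2 : ℤ_[2]) ^ t j)) := by
    have := hs.hasSum.tendsto_sum_nat
    refine this.congr fun j => ?_
    rw [hsum j]
    push_cast
    rfl
  have hzero : Tendsto (fun j => F (y j)) atTop (𝓝 0) := by
    refine squeeze_zero_norm (fun j => ?_)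
      (tendsto_pow_atTop_nhds_zero_of_lt_one (r := (1 / 2 : ℝ)) (by norm_num) (by norm_num))
    refine le_trans (le_of_eq ?_) (hpow j)
    have h1 := PadicInt.norm_p_pow (p := 2) (t j)
    rw [Nat.cast_ofNat, Nat.cast_ofNat] at h1
    rw [hnorm, h1]
  refine ⟨_, fun x => ?_, t, hmono, rfl, fun j => ?_, hs.hasSum⟩
  · have h1 : Tendsto (fun j => ‖F x - F (y j)‖) atTop (𝓝 ‖F x‖) := by
      simpa using (tendsto_const_nhds.sub hzero).norm
    have h2 : Tendsto (fun j => ‖F x - F (y j)‖) atTop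
        (𝓝 ‖(x : ℤ_[2]) - ∑' j, (2 : ℤ_[2]) ^ t j‖) := by
      simp only [hF]
      exact (tendsto_const_nhds.sub hlim).norm
    exact tendsto_nhds_unique h1 h2
  · change (F (y (j + 1))).valuation = _
    rw [hsum (j + 1)]

/-! ### From natural to integer arguments -/

theorem two_pow_dvd_pow_two_pow_sub_one {z : ℤ} (hz : Odd z) (N : ℕ) :
    (2 : ℤ) ^ N ∣ z ^ 2 ^ N - 1 := by
  induction N with
  | zero => simp
  | succ N ih =>
    have h : z ^ 2 ^ (N + 1) - 1 = (z ^ 2 ^ N - 1) * (z ^ 2 ^ N + 1) := by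
      rw [pow_succ 2 N, pow_mul]; ring
    rw [h, pow_succ]
    exact mul_dvd_mul ih (even_iff_two_dvd.1 (hz.pow.add_one))

open Filter Topology in
theorem tendsto_pow_two_pow_padic {z : ℤ} (hz : Odd z) :
    Tendsto (fun N : ℕ => (z : ℚ_[2]) ^ 2 ^ N) atTop (𝓝 1) := by
  rw [tendsto_iff_norm_sub_tendsto_zero]
  refine squeeze_zero (fun _ => norm_nonneg _) (fun N => ?_)
    (tendsto_pow_atTop_nhds_zero_of_lt_one (r := (1 / 2 : ℝ)) (by norm_num) (by norm_num))
  have h := (Padic.norm_int_le_pow_iff_dvd (p := 2) (z ^ 2 ^ N - 1) N).2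
    (by exact_mod_cast two_pow_dvd_pow_two_pow_sub_one hz N)
  push_cast at h
  rwa [zpow_neg, zpow_natCast, ← inv_pow, ← one_div] at h

open Filter Topology in
theorem tendsto_partialStirling_add (n M : ℕ) (k : ℤ) :
    Tendsto (fun N : ℕ => ((partialStirling n (k + (M * 2 ^ N : ℕ)) : ℚ) : ℚ_[2])) atTop
      (𝓝 ((partialStirling n k : ℚ) : ℚ_[2])) := by
  simp only [partialStirling, Rat.cast_sum, Rat.cast_mul, Rat.cast_zpow, Rat.cast_natCast]
  refine tendsto_finsetSum _ fun j hj => ?_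
  have hj : Odd j := (Finset.mem_filter.1 hj).2
  have hj0 : (j : ℚ_[2]) ≠ 0 := Nat.cast_ne_zero.2 hj.pos.ne'
  have h := tendsto_pow_two_pow_padic (z := (j : ℤ) ^ M) (by exact_mod_cast hj.pow)
  push_cast at h
  have h2 := (h.const_mul ((j : ℚ_[2]) ^ k)).const_mul (n.choose j : ℚ_[2])
  rw [mul_one] at h2
  refine h2.congr fun N => ?_
  rw [zpow_add₀ hj0, zpow_natCast, pow_mul]

theorem Padic.norm_natCast_of_odd {u : ℕ} (hu : Odd u) : ‖(u : ℚ_[2])‖ = 1 :=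
  Padic.norm_natCast_eq_one_iff.2 (Nat.coprime_two_left.2 hu)

theorem norm_partialStirling_sub_of_lt {s δ i a b : ℕ} (hs : 1 ≤ s) (hδ : δ ≤ 1) (hab : b < a) :
    ‖((partialStirling (2 * 2 ^ s + 1 + δ) (2 ^ s * (a : ℤ) + i) : ℚ) : ℚ_[2]) -
      ((partialStirling (2 * 2 ^ s + 1 + δ) (2 ^ s * (b : ℤ) + i) : ℚ) : ℚ_[2])‖ =
      ‖(2 : ℚ_[2]) ^ (2 * 2 ^ s - 1 + δ)‖ * ‖(a : ℚ_[2]) - b‖ := by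
  obtain ⟨d, hd, rfl⟩ : ∃ d, 0 < d ∧ a = b + d := ⟨a - b, by omega, by omega⟩
  obtain ⟨t, h, hh, rfl⟩ := Nat.exists_eq_two_pow_mul_odd hd.ne'
  obtain ⟨u, hu, hT⟩ := exists_odd_natPartialStirling_add (t := t) hs hδ hh (2 ^ s * b + i)
  have e1 : (2 ^ s * ((b + 2 ^ t * h : ℕ) : ℤ) + i : ℤ) =
      ((2 ^ s * b + i + 2 ^ s * (2 ^ t * h) : ℕ) : ℤ) := by push_cast; ring
  have e2 : (2 ^ s * (b : ℤ) + i : ℤ) = ((2 ^ s * b + i : ℕ) : ℤ) := by push_cast; ring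
  rw [e1, e2, partialStirling_natCast, partialStirling_natCast, hT]
  push_cast
  rw [add_sub_cancel_left, add_sub_cancel_left, norm_mul, norm_mul, norm_mul,
    Padic.norm_natCast_of_odd hu, Padic.norm_natCast_of_odd hh]

open Filter Topology in
theorem norm_partialStirling_sub {s δ : ℕ} (hs : 1 ≤ s) (hδ : δ ≤ 1) (i : ℕ) (x y : ℤ) :
    ‖((partialStirling (2 * 2 ^ s + 1 + δ) (2 ^ s * x + i) : ℚ) : ℚ_[2]) -
      ((partialStirling (2 * 2 ^ s + 1 + δ) (2 ^ s * y + i) : ℚ) : ℚ_[2])‖ =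
      ‖(2 : ℚ_[2]) ^ (2 * 2 ^ s - 1 + δ)‖ * ‖(x : ℚ_[2]) - y‖ := by
  wlog hxy : y < x generalizing x y
  · rcases (not_lt.1 hxy).eq_or_lt with rfl | h
    · simp
    · rw [norm_sub_rev, this y x h, norm_sub_rev (x : ℚ_[2])]
  have h1 := ((tendsto_partialStirling_add (2 * 2 ^ s + 1 + δ) (2 ^ s) (2 ^ s * x + i)).sub
    (tendsto_partialStirling_add (2 * 2 ^ s + 1 + δ) (2 ^ s) (2 ^ s * y + i))).norm
  -- Translating x and y by 2^N keeps x - y fixed and makes both natural once N ≥ |y|; the norm is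
  -- then constant in N.
  refine tendsto_nhds_unique h1 (tendsto_const_nhds.congr' ?_)
  filter_upwards [eventually_ge_atTop y.natAbs] with N hN
  have hN' : (y.natAbs : ℤ) < 2 ^ N := by exact_mod_cast hN.trans_lt Nat.lt_two_pow_self
  obtain ⟨b, hb⟩ := Int.eq_ofNat_of_zero_le (a := y + 2 ^ N) (by omega)
  obtain ⟨a, ha⟩ := Int.eq_ofNat_of_zero_le (a := x + 2 ^ N) (by omega)
  have hx : x = a - 2 ^ N := by omega
  have hy : y = b - 2 ^ N := by omega
  have h := norm_partialStirling_sub_of_lt (i := i) hs hδ (show b < a by omega)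
  rw [show (2 ^ s * x + i + (2 ^ s * 2 ^ N : ℕ) : ℤ) = 2 ^ s * (a : ℤ) + i by
    rw [hx]; push_cast; ring,
    show (2 ^ s * y + i + (2 ^ s * 2 ^ N : ℕ) : ℤ) = 2 ^ s * (b : ℤ) + i by
      rw [hy]; push_cast; ring, h, hx, hy]
  push_cast
  rw [sub_sub_sub_cancel_right]

theorem partialStirling_pos {n : ℕ} (hn : 1 ≤ n) (k : ℤ) : 0 < partialStirling n k := by
  refine Finset.sum_pos' (fun j _ => by positivity) ⟨1, ?_, ?_⟩
  · rw [Finset.mem_filter, Finset.mem_range]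
    exact ⟨by omega, odd_one⟩
  · simpa using Nat.lt_of_succ_le hn

/-- The values of `T_n` at arguments congruent to `i` modulo `2 ^ s`, divided by `2 ^ (n - 2)`. -/
theorem exists_padicInt_partialStirling_eq {s δ : ℕ} (hs : 1 ≤ s) (hδ : δ ≤ 1) (i c : ℕ)
    (hc : natPartialStirling (2 * 2 ^ s + 1 + δ) (2 ^ s + i) = 2 ^ (2 * 2 ^ s - 1 + δ) * c) :
    ∃ F : ℤ → ℤ_[2], (∀ x, ((partialStirling (2 * 2 ^ s + 1 + δ) (2 ^ s * x + i) : ℚ) : ℚ_[2]) =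
        2 ^ (2 * 2 ^ s - 1 + δ) * (F x : ℚ_[2])) ∧
      (∀ x y, ‖F x - F y‖ = ‖(x : ℤ_[2]) - y‖) ∧ F 1 = c := by
  set f : ℤ → ℚ_[2] := fun x =>
    ((partialStirling (2 * 2 ^ s + 1 + δ) (2 ^ s * x + i) : ℚ) : ℚ_[2]) /
      2 ^ (2 * 2 ^ s - 1 + δ) with hf
  have hp : (2 : ℚ_[2]) ^ (2 * 2 ^ s - 1 + δ) ≠ 0 := by norm_num
  have hsub : ∀ x y, ‖f x - f y‖ = ‖(x : ℚ_[2]) - y‖ := fun x y => by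
    rw [hf]
    dsimp only
    rw [← sub_div, norm_div, norm_partialStirling_sub hs hδ, mul_div_cancel_left₀]
    exact norm_ne_zero_iff.2 hp
  have h1 : f 1 = c := by
    have e : (2 ^ s * 1 + i : ℤ) = ((2 ^ s + i : ℕ) : ℤ) := by push_cast; ring
    rw [hf]
    dsimp only
    rw [e, partialStirling_natCast, hc, div_eq_iff hp]
    push_cast
    ring
  -- Integrality at x = 1 spreads to every x, since f x - f 1 has the norm of the integer x - 1.
  have hle : ∀ x, ‖f x‖ ≤ 1 := fun x => by
    have h2 := Padic.nonarchimedean (f x - f 1) (f 1)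
    rw [sub_add_cancel, hsub, h1] at h2
    refine h2.trans (max_le ?_ ?_)
    · exact_mod_cast Padic.norm_int_le_one (p := 2) (x - 1)
    · exact_mod_cast Padic.norm_int_le_one (p := 2) c
  refine ⟨fun x => ⟨f x, hle x⟩, fun x => ?_, fun x y => ?_, ?_⟩
  · exact (mul_div_cancel₀ _ hp).symm
  · rw [PadicInt.norm_def, PadicInt.norm_def]
    push_cast
    exact hsub x y
  · apply PadicInt.ext
    rw [PadicInt.coe_natCast]
    exact h1

/-- The `2`-adic zero of `T_n`, with its value at `2 ^ s + i` as a residue. -/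
theorem exists_zero_partialStirling {s δ n : ℕ} (hs : 1 ≤ s) (hδ : δ ≤ 1)
    (hn : n = 2 * 2 ^ s + 1 + δ) (i c : ℕ)
    (hc : natPartialStirling n (2 ^ s + i) = 2 ^ (2 * 2 ^ s - 1 + δ) * c) :
    ∃ ξ : ℤ_[2],
      (∀ x : ℤ, partialStirling n (2 ^ s * x + i) ≠ 0 ∧ (x : ℤ_[2]) - ξ ≠ 0 ∧
        padicValRat 2 (partialStirling n (2 ^ s * x + i)) =
          (((x : ℤ_[2]) - ξ).valuation : ℤ) + ((n : ℤ) - 2)) ∧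
      ‖ξ - 1‖ = ‖(c : ℤ_[2])‖ ∧
      (∃ t : ℕ → ℕ, StrictMono t ∧
        (t 0 : ℤ) = shiftedExponent (s + 1) n i 0 ∧
        (∀ j : ℕ, (t (j + 1) : ℤ) =
          shiftedExponent (s + 1) n i (∑ l ∈ Finset.range (j + 1), 2 ^ t l)) ∧
        HasSum (fun j : ℕ => (2 : ℤ_[2]) ^ t j) ξ) := by
  subst hn
  have hM : 1 ≤ 2 ^ s := Nat.one_le_two_pow
  obtain ⟨F, hF, hsub, h1⟩ := exists_padicInt_partialStirling_eq hs hδ i c hc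
  have hT : ∀ x : ℤ, partialStirling (2 * 2 ^ s + 1 + δ) (2 ^ s * x + i) ≠ 0 := fun x =>
    (partialStirling_pos (by omega) _).ne'
  have hF0 : ∀ x, F x ≠ 0 := fun x h => by
    have h2 := hF x
    rw [h, PadicInt.coe_zero, mul_zero, Rat.cast_eq_zero] at h2
    exact hT x h2
  have hval : ∀ x, padicValRat 2 (partialStirling (2 * 2 ^ s + 1 + δ) (2 ^ s * x + i)) =
      ((F x).valuation : ℤ) + (((2 * 2 ^ s + 1 + δ : ℕ) : ℤ) - 2) := fun x => by
    rw [← Padic.valuation_ratCast, hF, Padic.valuation_mul (by norm_num)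
      (PadicInt.coe_ne_zero.2 (hF0 x)), Padic.valuation_pow, PadicInt.valuation_coe]
    have h2 := Padic.valuation_p (p := 2)
    rw [Nat.cast_ofNat] at h2
    rw [h2]
    push_cast [Nat.cast_sub (show 1 ≤ 2 * 2 ^ s by omega)]
    ring
  obtain ⟨ξ, hξ, t, ht, ht0, htj, hts⟩ := exists_padicInt_zero_of_isometry hF0 hsub
  have hshift : ∀ x, shiftedExponent (s + 1) (2 * 2 ^ s + 1 + δ) i x = (F x).valuation := fun x => by
    rw [shiftedExponent, Nat.add_sub_cancel, hval, add_sub_cancel_right]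
  have hne : ∀ x : ℤ, (x : ℤ_[2]) - ξ ≠ 0 := fun x => by
    rw [← norm_ne_zero_iff, ← hξ x, norm_ne_zero_iff]
    exact hF0 x
  refine ⟨ξ, fun x => ⟨hT x, hne x, ?_⟩, ?_, t, ht, ?_, fun j => ?_, hts⟩
  · have h2 := hξ x
    rw [PadicInt.norm_eq_zpow_neg_valuation (hF0 x), PadicInt.norm_eq_zpow_neg_valuation (hne x),
      zpow_right_inj₀ (by norm_num) (by norm_num), neg_inj] at h2
    rw [hval, h2]
  · rw [← h1, hξ, norm_sub_rev, Int.cast_one]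
  · rw [hshift, ht0]
  · rw [hshift, htj]

/-! ### Residues of the zero, and the theorem -/

theorem two_pow_dvd_of_norm_eq {z : ℤ_[2]} {k c : ℕ} (h : ‖z‖ = ‖((2 ^ k * c : ℕ) : ℤ_[2])‖) :
    (2 : ℤ_[2]) ^ k ∣ z := by
  have h1 : z ∈ Ideal.span {((2 : ℕ) : ℤ_[2]) ^ k} := by
    refine (PadicInt.norm_le_pow_iff_mem_span_pow z k).1 ?_
    rw [h, Nat.cast_mul, norm_mul, Nat.cast_pow, PadicInt.norm_p_pow]
    exact mul_le_of_le_one_right (by positivity) (PadicInt.norm_le_one _)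
  rw [Ideal.mem_span_singleton] at h1
  exact_mod_cast h1

theorem two_pow_succ_dvd_of_norm_eq {z : ℤ_[2]} {k c : ℕ} (hc : Odd c)
    (h : ‖z‖ = ‖((2 ^ k * c : ℕ) : ℤ_[2])‖) : (2 : ℤ_[2]) ^ (k + 1) ∣ z - 2 ^ k := by
  obtain ⟨a, rfl⟩ := two_pow_dvd_of_norm_eq h
  have h1 : ‖a‖ = 1 := by
    have hc1 : ‖(c : ℤ_[2])‖ = 1 :=
      PadicInt.norm_natCast_eq_one_iff.2 (Nat.coprime_two_left.2 hc)
    push_cast at h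
    rw [norm_mul, norm_mul, hc1] at h
    exact mul_left_cancel₀ (norm_ne_zero_iff.2 (by norm_num)) h
  obtain ⟨m, hm, h2⟩ := PadicInt.exists_mem_range (p := 2) a
  rw [PadicInt.maximalIdeal_eq_span_p, Ideal.mem_span_singleton] at h2
  interval_cases m
  · rw [Nat.cast_zero, sub_zero] at h2
    have := (PadicInt.norm_lt_one_iff_dvd a).2 h2
    rw [h1] at this
    exact absurd this (lt_irrefl _)
  · obtain ⟨b, hb⟩ := h2
    refine ⟨b, ?_⟩
    push_cast at hb
    rw [pow_succ]
    linear_combination 2 ^ k * hb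

theorem theorem1p1 (e n i : ℕ) (he : 2 ≤ e) (hn : n = 2 ^ e + 1 ∨ n = 2 ^ e + 2)
    (hi : 1 ≤ i) (hi' : i ≤ 2 ^ (e - 1)) :
    ∃ ξ : ℤ_[2],
      -- the exponent formula; both sides are exponents of nonzero numbers
      (∀ x : ℤ, partialStirling n (2 ^ (e - 1) * x + i) ≠ 0 ∧ (x : ℤ_[2]) - ξ ≠ 0 ∧
        padicValRat 2 (partialStirling n (2 ^ (e - 1) * x + i)) =
          (((x : ℤ_[2]) - ξ).valuation : ℤ) + ((n : ℤ) - 2)) ∧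
      -- the residue of `ξ` for `n = 2 ^ e + 1`
      (n = 2 ^ e + 1 →
        ((i = 2 ^ (e - 2) ∨ i = 2 ^ (e - 1)) → (2 : ℤ_[2]) ^ (i + 1) ∣ ξ - (1 + 2 ^ i)) ∧
        (¬ (i = 2 ^ (e - 2) ∨ i = 2 ^ (e - 1)) → (2 : ℤ_[2]) ^ (i + 1) ∣ ξ - 1)) ∧
      -- the residue of `ξ` for `n = 2 ^ e + 2`
      (n = 2 ^ e + 2 →
        (i ≤ 2 ^ (e - 2) → (2 : ℤ_[2]) ^ i ∣ ξ - (1 + 2 ^ (i - 1))) ∧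
        ((2 ^ (e - 2) < i ∧ i < 2 ^ (e - 1) ∧ ¬ (e = 3 ∧ i = 3)) →
          (2 : ℤ_[2]) ^ (i + 1) ∣ ξ - (1 + 2 ^ i)) ∧
        ((i = 2 ^ (e - 1) ∨ (e = 3 ∧ i = 3)) → (2 : ℤ_[2]) ^ (i + 1) ∣ ξ - 1)) ∧
      -- the binary expansion of `ξ`
      (∃ t : ℕ → ℕ, StrictMono t ∧
        (t 0 : ℤ) = shiftedExponent e n i 0 ∧
        (∀ j : ℕ, (t (j + 1) : ℤ) =
          shiftedExponent e n i (∑ l ∈ Finset.range (j + 1), 2 ^ t l)) ∧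
        HasSum (fun j : ℕ => (2 : ℤ_[2]) ^ t j) ξ) := by
  obtain ⟨s, rfl⟩ := Nat.exists_eq_add_of_le' (Nat.le_of_succ_le he)
  have hs : 1 ≤ s := by omega
  have e2 : s + 1 - 2 = s - 1 := by omega
  rw [pow_succ' 2 s] at hn
  rw [Nat.add_sub_cancel] at hi'
  simp only [Nat.add_sub_cancel, e2, pow_succ' 2 s]
  rcases hn with hn | hn
  · obtain ⟨u, w, hu, hT⟩ := exists_natPartialStirling_two_mul_add_one hi hi'
    have hpar := odd_stirlingSecond_two_pow_iff hs hi hi'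
    obtain ⟨ξ, h1, h2, h3⟩ := exists_zero_partialStirling (δ := 0) hs (by omega) hn i _
      (by rw [hn]; exact hT)
    refine ⟨ξ, h1, fun _ => ⟨fun h => ?_, fun h => ?_⟩, fun h => by omega, h3⟩
    · rw [← sub_sub]
      exact two_pow_succ_dvd_of_norm_eq (((hpar.2 h).mul hu).add_even (even_two_mul w)) h2
    · rw [← hpar, Nat.not_odd_iff_even] at h
      obtain ⟨c, hc⟩ := h
      refine two_pow_dvd_of_norm_eq (c := c * u + w) (h2.trans ?_)
      rw [hc, pow_succ]
      congr 2
      ring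
  · obtain ⟨u, v, w, hu, hv, hT⟩ := exists_natPartialStirling_two_mul_add_two hs hi hi'
    have hpar := odd_stirlingSecond_two_pow_iff hs hi hi'
    have hpow : 2 ^ s = 2 * 2 ^ (s - 1) := by rw [← pow_succ']; congr 1; omega
    have hpos : 0 < 2 ^ (s - 1) := by positivity
    obtain ⟨k, rfl⟩ := Nat.exists_eq_add_of_le' hi
    rw [Nat.add_sub_cancel] at hT
    obtain ⟨ξ, h1, h2, h3⟩ := exists_zero_partialStirling (δ := 1) hs le_rfl hn (k + 1) _
      (by
        rw [hn, show 2 * 2 ^ s - 1 + 1 = 2 * 2 ^ s by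
          have := Nat.one_le_two_pow (n := s)
          omega]
        exact hT)
    refine ⟨ξ, h1, fun h => by omega, fun _ => ⟨fun h => ?_, fun h => ?_, fun h => ?_⟩, h3⟩
    · rw [← sub_sub]
      refine two_pow_succ_dvd_of_norm_eq (k := k) ?_ h2
      have h4 := odd_stirlingSecond_two_pow_add_one hs hi h
      exact ((h4.mul hu).add_even (even_two_mul _)).add_even ⟨2 * w, by ring⟩
    -- Here S(2^s+i, 2^s+1) is 2 modulo 4 and S(2^s+i, 2^s) is even, so the bracket is 2 times an
    -- odd number.
    · have h4 := stirlingSecond_two_pow_add_one_mod_four hs h.1 hi' (fun h5 => h.2.2 (by omega))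
      have h5 : Even ((2 ^ s + (k + 1)).stirlingSecond (2 ^ s)) := by
        rw [← Nat.not_odd_iff_even, hpar]
        omega
      obtain ⟨c, hc⟩ : ∃ c, (2 ^ s + (k + 1)).stirlingSecond (2 ^ s + 1) = 2 * (2 * c + 1) :=
        ⟨(2 ^ s + (k + 1)).stirlingSecond (2 ^ s + 1) / 4, by omega⟩
      rw [← sub_sub]
      refine two_pow_succ_dvd_of_norm_eq (k := k + 1) (c := (2 * c + 1) * u +
        (2 ^ s + (k + 1)).stirlingSecond (2 ^ s) * v + 2 * w) ?_ (h2.trans ?_)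
      · exact (((odd_two_mul_add_one c).mul hu).add_even (h5.mul_right v)).add_even
          (even_two_mul w)
      · rw [hc, pow_succ]
        congr 2
        ring
    · suffices h4 : 4 ∣ (2 ^ s + (k + 1)).stirlingSecond (2 ^ s + 1) * u +
          2 * ((2 ^ s + (k + 1)).stirlingSecond (2 ^ s) * v) + 4 * w by
        obtain ⟨c, hc⟩ := h4
        refine two_pow_dvd_of_norm_eq (c := c) (h2.trans ?_)
        rw [hc, pow_succ, pow_succ]
        congr 2
        ring
      refine dvd_add ?_ (dvd_mul_right 4 w)
      -- The exceptional case has S(7, 5) = 140 and S(7, 4) = 350. For i = 2^s both summands are 2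
      -- modulo 4 and cancel.
      by_cases h33 : s = 2 ∧ k = 2
      · obtain ⟨rfl, rfl⟩ := h33
        exact dvd_add (Dvd.dvd.mul_right (by decide) u)
          ((mul_dvd_mul_left 2 (Dvd.dvd.mul_right (by decide : 2 ∣ _) v)))
      · have hk : k + 1 = 2 ^ s := h.resolve_right (by omega)
        have h4 := stirlingSecond_two_pow_add_one_mod_four hs (by omega) hi' (by omega)
        obtain ⟨c, hc⟩ : ∃ c, (2 ^ s + (k + 1)).stirlingSecond (2 ^ s + 1) = 2 * (2 * c + 1) :=
          ⟨(2 ^ s + (k + 1)).stirlingSecond (2 ^ s + 1) / 4, by omega⟩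
        obtain ⟨d, hd⟩ := ((odd_two_mul_add_one c).mul hu).add_odd
          ((hpar.2 (Or.inr hk)).mul hv)
        refine ⟨d, ?_⟩
        rw [hc]
        linear_combination 2 * hd
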